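/- Let $(R,\mathfrak m)$ be a (commutative Noetherian) local ring with $\dim R=1$, and let $M$ be a nonzero finitely generated $R$-module which has rank $r$, i.e. for every associated prime $\mathfrak p$ of $R$ the $R_{\mathfrak p}$-module $M_{\mathfrak p}$ is free of rank $r$. Write $M^*=\operatorname{Hom}_R(M,R)$, let $\nu_R(-)$ denote the minimal number of generators, let $e(R)=\lim_{n\to\infty}\operatorname{length}_R(R/\mathfrak m^n)/n$ be the multiplicity of $R$, and let $\operatorname{tr}_R(M)$ be the trace of $M$, i.e. the image of the map $M^*\otimes_R M\to R$, $f\otimes x\mapsto f(x)$. Assume that $M\otimes_R M^*$ is torsionfree, i.e. no regular element of $R$ kills a nonzero element of it, and put $\rho=r/\nu_R(M)$. Then every ideal $J$ of $R$ with $J\supseteq\operatorname{tr}_R(M)$ satisfies $$\nu_R(J)\;\le\; e(R)(1-\rho)+\frac{\nu_R(M\otimes_R M^*)}{\nu_R(M)^2}\;\le\; e(R)(1-\rho+\rho^2).$$ In particular, if $r>0$ and $M$ is not free, then $\nu_R(J)\le e(R)-1$. -/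

import Mathlib

open scoped TensorProduct

/-- The minimal number of generators `ν_R(M)` of a (finitely generated) module `M`. -/
noncomputable def numGenerators (R M : Type*) [CommRing R] [AddCommGroup M] [Module R M] : ℕ :=
  (⊤ : Submodule R M).spanFinrank

/-- `M` has rank `r`: for every associated prime `p` of `R`, the localization `M_p` is a free
`R_p`-module of rank `r`. -/
def ModuleHasRank (R M : Type*) [CommRing R] [AddCommGroup M] [Module R M] (r : ℕ) : Prop :=
  ∀ (p : Ideal R) [p.IsPrime], p ∈ associatedPrimes R R →
    Module.Free (Localization.AtPrime p) (LocalizedModule p.primeCompl M) ∧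
      Module.finrank (Localization.AtPrime p) (LocalizedModule p.primeCompl M) = r

/-- The trace of `M`: the image of the evaluation map `M* ⊗ M → R`, `f ⊗ x ↦ f x`. -/
noncomputable def moduleTrace (R M : Type*) [CommRing R] [AddCommGroup M] [Module R M] :
    Ideal R :=
  LinearMap.range (contractLeft R M)

/-- The Krull dimension of a local ring as a natural number (it is finite for a Noetherian local
ring). -/
noncomputable def localDim (R : Type*) [CommRing R] : ℕ :=
  ((ringKrullDim R).unbotD 0).toNat

/-- The (Hilbert–Samuel) multiplicity `e(R) = lim_{n → ∞} d! · length(R / 𝔪ⁿ) / n ^ d` of a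
Noetherian local ring `(R, 𝔪)` of dimension `d`; the limit always exists. -/
noncomputable def localMultiplicity (R : Type*) [CommRing R] [IsLocalRing R] : ℝ :=
  Filter.limUnder Filter.atTop fun n : ℕ =>
    ((localDim R).factorial : ℝ) *
      ((Module.length R (R ⧸ IsLocalRing.maximalIdeal R ^ n)).toNat : ℝ) / (n : ℝ) ^ localDim R

/-! Write n = ν(M), e = e(R), and suppose that 𝔪 contains a regular element. Evaluation at n
generators of M embeds M* into J^n, because J contains the trace. The cokernel C of this embedding
satisfies C × R^r ↪ R^n. The key count is that N × R^r ↪ R^n forces ν(N) ≤ (n - r)e. It gives n ν(J)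
≤ ν(M*) + (n - r)e, and dividing by n yields the first bound, since ν(M ⊗ M*) = n ν(M*).
Torsionfreeness embeds M ⊗ M* into R^(r²), so the same count gives ν(M ⊗ M*) ≤ r²e, the second
bound. If M is not free and r > 0, then 0 < ρ < 1, so the bound is strictly below the integer e. If
𝔪 has no regular element, then M is isomorphic to R^r and J = R.

The count would be classical with a principal reduction (y) of 𝔪, by comparing lengths of N/yN, but
y need not exist when the residue field is finite. Instead, a finite free local extension S of R
with maximal ideal 𝔪S is chosen so that 𝔪S has a principal reduction (y). Multiplication by y on S ≅
R^d is a matrix A over R, and the length of N^d / A N^d replaces that of N/yN. This length is at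
least d ν(N), equals d e for N = R, and does not increase on submodules of torsionfree finite
modules.

The argument rests on `exists_isMatrixReduction`, `IsMatrixReduction.matrixLength_le`,
`IsMatrixReduction.numGenerators_add_le`, `ModuleHasRank.exists_linearMap` and
`IsMatrixReduction.exists_numGenerators_ideal_le`. -/

open IsLocalRing in
theorem numGenerators_eq_finrank (R P : Type*) [CommRing R] [IsLocalRing R] [AddCommGroup P]
    [Module R P] [Module.Finite R P] :
    numGenerators R P = Module.finrank (ResidueField R) (ResidueField R ⊗[R] P) := by
  have h := TensorProduct.spanFinrank_top_eq_of_residueField (⊤ : Submodule R P) Module.Finite.fg_top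
  rw [← Module.finrank_eq_spanFinrank_of_free] at h
  rw [numGenerators, ← h]
  exact (Submodule.topEquiv.baseChange R (ResidueField R) _ _).finrank_eq

/-! ### Minimal numbers of generators over a local ring -/

section numGenerators

variable {R P Q : Type*} [CommRing R] [AddCommGroup P] [Module R P] [AddCommGroup Q] [Module R Q]

theorem numGenerators_le_of_surjective [Module.Finite R P] (f : P →ₗ[R] Q)
    (hf : Function.Surjective f) : numGenerators R Q ≤ numGenerators R P := by
  have h := Submodule.spanFinrank_map_le_of_fg f (Module.Finite.fg_top (R := R) (M := P))
  rwa [Submodule.map_top, LinearMap.range_eq_top.mpr hf] at h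

theorem LinearEquiv.numGenerators_eq [Module.Finite R P] (e : P ≃ₗ[R] Q) :
    numGenerators R P = numGenerators R Q := by
  have := Module.Finite.equiv e
  exact (numGenerators_le_of_surjective e.symm.toLinearMap e.symm.surjective).antisymm
    (numGenerators_le_of_surjective e.toLinearMap e.surjective)

theorem exists_surjective_of_numGenerators [Module.Finite R P] :
    ∃ f : (Fin (numGenerators R P) → R) →ₗ[R] P, Function.Surjective f := by
  obtain ⟨s, hs, h⟩ :=
    (Module.Finite.fg_top (R := R) (M := P)).exists_span_finset_card_eq_spanFinrank
  let e : Fin (numGenerators R P) ≃ s := (finCongr hs.symm).trans s.equivFin.symm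
  refine ⟨Fintype.linearCombination R fun i => (e i : P), ?_⟩
  rw [← LinearMap.range_eq_top, Fintype.range_linearCombination, ← h]
  congr 1
  ext x
  simp only [Set.mem_range, SetLike.mem_coe]
  exact ⟨fun ⟨i, hi⟩ => hi ▸ (e i).2, fun hx => ⟨e.symm ⟨x, hx⟩, by simp⟩⟩

theorem numGenerators_eq_zero_iff [Module.Finite R P] :
    numGenerators R P = 0 ↔ Subsingleton P := by
  rw [numGenerators, Submodule.spanFinrank_eq_zero_iff_eq_bot Module.Finite.fg_top,
    ← Submodule.subsingleton_iff R, eq_comm]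
  exact subsingleton_iff_bot_eq_top

variable [IsLocalRing R]

theorem numGenerators_le_add [Module.Finite R P] [Module.Finite R Q] (f : P →ₗ[R] Q)
    (hf : Function.Surjective f) {K : Type*} [AddCommGroup K] [Module R K] [Module.Finite R K]
    (g : K →ₗ[R] P) (h : Function.Exact g f) :
    numGenerators R P ≤ numGenerators R K + numGenerators R Q := by
  simp only [numGenerators_eq_finrank]
  set k := IsLocalRing.ResidueField R
  have hex : Function.Exact (g.baseChange k) (f.baseChange k) := lTensor_exact k h hf
  have hsur : Function.Surjective (f.baseChange k) := LinearMap.lTensor_surjective k hf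
  rw [← (f.baseChange k).finrank_range_add_finrank_ker, LinearMap.exact_iff.mp hex, add_comm]
  exact Nat.add_le_add (LinearMap.finrank_range_le _) (Submodule.finrank_le _)

theorem numGenerators_pi [Module.Finite R P] (n : ℕ) :
    numGenerators R (Fin n → P) = n * numGenerators R P := by
  simp only [numGenerators_eq_finrank]
  rw [(TensorProduct.piRight R (IsLocalRing.ResidueField R) (IsLocalRing.ResidueField R)
    (fun _ : Fin n => P)).finrank_eq, Module.finrank_pi_fintype]
  simp

theorem numGenerators_tensorProduct [Module.Finite R P] [Module.Finite R Q] :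
    numGenerators R (P ⊗[R] Q) = numGenerators R P * numGenerators R Q := by
  simp only [numGenerators_eq_finrank]
  rw [(TensorProduct.AlgebraTensorModule.distribBaseChange R (IsLocalRing.ResidueField R)
    P Q).finrank_eq, Module.finrank_tensorProduct]

theorem length_quotient_maximalIdeal_smul [Module.Finite R P] :
    Module.length R (P ⧸ (IsLocalRing.maximalIdeal R • ⊤ : Submodule R P)) =
      numGenerators R P := by
  rw [numGenerators_eq_finrank, ← Module.length_eq_finrank,
    ← Module.length_eq_of_surjective (S := R) (R := IsLocalRing.ResidueField R)
      IsLocalRing.residue_surjective]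
  exact (TensorProduct.quotTensorEquivQuotSMul P (IsLocalRing.maximalIdeal R)).symm.length_eq

end numGenerators

/-! ### Lengths of cokernels -/

section length

variable {R X Y Z : Type*} [CommRing R] [AddCommGroup X] [Module R X] [AddCommGroup Y] [Module R Y]
  [AddCommGroup Z] [Module R Z]

theorem length_quotient_range_comp_le (f : X →ₗ[R] Y) (g : Y →ₗ[R] Z) :
    Module.length R (Z ⧸ LinearMap.range (g ∘ₗ f)) ≤
      Module.length R (Y ⧸ LinearMap.range f) + Module.length R (Z ⧸ LinearMap.range g) := by
  let a : (Y ⧸ LinearMap.range f) →ₗ[R] (Z ⧸ LinearMap.range (g ∘ₗ f)) :=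
    Submodule.mapQ _ _ g (by rintro _ ⟨x, rfl⟩; exact ⟨x, rfl⟩)
  let b : (Z ⧸ LinearMap.range (g ∘ₗ f)) →ₗ[R] (Z ⧸ LinearMap.range g) :=
    Submodule.factor (LinearMap.range_comp_le_range f g)
  have hb : Function.Surjective b := Submodule.factor_surjective _
  have hex : LinearMap.range a = LinearMap.ker b := by
    simp [a, b, Submodule.range_mapQ, Submodule.factor, Submodule.ker_mapQ]
  rw [Module.length_eq_add_of_exact (LinearMap.ker b).subtype b (Submodule.injective_subtype _) hb
    (LinearMap.exact_subtype_ker_map b), ← hex]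
  gcongr
  exact Module.length_le_of_surjective a.rangeRestrict a.surjective_rangeRestrict

theorem length_quotient_range_comp (f : X →ₗ[R] Y) (g : Y →ₗ[R] Z) (hg : Function.Injective g) :
    Module.length R (Z ⧸ LinearMap.range (g ∘ₗ f)) =
      Module.length R (Y ⧸ LinearMap.range f) + Module.length R (Z ⧸ LinearMap.range g) := by
  let a : (Y ⧸ LinearMap.range f) →ₗ[R] (Z ⧸ LinearMap.range (g ∘ₗ f)) :=
    Submodule.mapQ _ _ g (by rintro _ ⟨x, rfl⟩; exact ⟨x, rfl⟩)
  let b : (Z ⧸ LinearMap.range (g ∘ₗ f)) →ₗ[R] (Z ⧸ LinearMap.range g) :=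
    Submodule.factor (LinearMap.range_comp_le_range f g)
  have hb : Function.Surjective b := Submodule.factor_surjective _
  have hex : LinearMap.range a = LinearMap.ker b := by
    simp [a, b, Submodule.range_mapQ, Submodule.factor, Submodule.ker_mapQ]
  have ha : Function.Injective a := by
    rw [← LinearMap.ker_eq_bot, Submodule.ker_mapQ, LinearMap.range_comp,
      Submodule.comap_map_eq_of_injective hg]
    simp
  exact Module.length_eq_add_of_exact a b ha hb (LinearMap.exact_iff.mpr hex.symm)

/-- An injective endomorphism has cokernels of the same length on a module and on a stable
submodule of finite colength. -/
theorem length_quotient_range_eq_of_comm (j : X →ₗ[R] Y) (hj : Function.Injective j)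
    (hfin : Module.length R (Y ⧸ LinearMap.range j) ≠ ⊤) (φ : Y →ₗ[R] Y)
    (hφ : Function.Injective φ) (ψ : X →ₗ[R] X) (h : φ ∘ₗ j = j ∘ₗ ψ) :
    Module.length R (Y ⧸ LinearMap.range φ) = Module.length R (X ⧸ LinearMap.range ψ) := by
  have h1 := length_quotient_range_comp j φ hφ
  rw [h, length_quotient_range_comp ψ j hj, add_comm] at h1
  exact (ENat.add_left_injective_of_ne_top hfin (by simpa only [add_comm] using h1)).symm

/-- The colength of φ(j(X)) = j(ψ(X)) in Y is computed along both factorizations. Since φ may have a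
kernel, only an inequality survives; this allows multiplication by a zero divisor. -/
theorem length_quotient_range_le_of_comm (j : X →ₗ[R] Y) (hj : Function.Injective j)
    (hfin : Module.length R (Y ⧸ LinearMap.range j) ≠ ⊤) (φ : Y →ₗ[R] Y)
    (ψ : X →ₗ[R] X) (h : φ ∘ₗ j = j ∘ₗ ψ) :
    Module.length R (X ⧸ LinearMap.range ψ) ≤ Module.length R (Y ⧸ LinearMap.range φ) := by
  have h1 := length_quotient_range_comp_le j φ
  rw [h, length_quotient_range_comp ψ j hj, add_comm] at h1
  exact (ENat.add_le_add_iff_left hfin).mp h1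

end length

/-! ### Matrices acting on powers of a module, and matrix reductions -/

section matrixAction

variable {R : Type*} [CommRing R] {ι : Type*} [Fintype ι]

/-- The action of a square matrix over `R` on column vectors with entries in a module. -/
def matrixAction (A : Matrix ι ι R) (N : Type*) [AddCommGroup N] [Module R N] :
    (ι → N) →ₗ[R] (ι → N) :=
  LinearMap.pi fun i => ∑ j, A i j • LinearMap.proj j

variable {N Q : Type*} [AddCommGroup N] [Module R N] [AddCommGroup Q] [Module R Q]

@[simp]
theorem matrixAction_apply (A : Matrix ι ι R) (v : ι → N) (i : ι) :
    matrixAction A N v i = ∑ j, A i j • v j := by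
  simp [matrixAction]

theorem matrixAction_mul (A B : Matrix ι ι R) (v : ι → N) :
    matrixAction (A * B) N v = matrixAction A N (matrixAction B N v) := by
  ext i
  simp only [matrixAction_apply, Matrix.mul_apply, Finset.smul_sum, Finset.sum_smul, mul_smul]
  exact Finset.sum_comm

theorem matrixAction_smul_one [DecidableEq ι] (a : R) (v : ι → N) :
    matrixAction (a • (1 : Matrix ι ι R)) N v = a • v := by
  ext i
  simp [Matrix.one_apply]

theorem matrixAction_compLeft (A : Matrix ι ι R) (f : N →ₗ[R] Q) :
    matrixAction A Q ∘ₗ f.compLeft ι = f.compLeft ι ∘ₗ matrixAction A N := by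
  ext v i
  simp

theorem matrixAction_injective [DecidableEq ι] [Module.IsTorsionFree R N] (A : Matrix ι ι R)
    (hA : IsRegular A.det) : Function.Injective (matrixAction A N) := by
  rw [← LinearMap.ker_eq_bot, LinearMap.ker_eq_bot']
  intro v hv
  have h : A.det • v = 0 := by
    rw [← matrixAction_smul_one, ← Matrix.adjugate_mul, matrixAction_mul, hv, map_zero]
  ext i
  exact hA.isSMulRegular (by simpa using congrFun h i)

/-- The length of the cokernel of the action of a matrix. -/
noncomputable def matrixLength (A : Matrix ι ι R) (N : Type*) [AddCommGroup N] [Module R N] : ℕ∞ :=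
  Module.length R ((ι → N) ⧸ LinearMap.range (matrixAction A N))

theorem LinearEquiv.matrixLength_eq (e : N ≃ₗ[R] Q) (A : Matrix ι ι R) :
    matrixLength A N = matrixLength A Q := by
  refine (Submodule.Quotient.equiv _ _ (LinearEquiv.piCongrRight fun _ : ι => e) ?_).length_eq
  ext v
  simp only [Submodule.mem_map, LinearMap.mem_range, exists_exists_eq_and]
  constructor
  · rintro ⟨w, rfl⟩
    exact ⟨fun i => e (w i), funext fun i => by simp⟩
  · rintro ⟨w, rfl⟩
    exact ⟨fun i => e.symm (w i), funext fun i => by simp⟩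

theorem matrixLength_pi (A : Matrix ι ι R) (κ : Type*) [Fintype κ] :
    matrixLength A (κ → N) = Fintype.card κ * matrixLength A N := by
  let F : (ι → κ → N) →ₗ[R] (κ → ((ι → N) ⧸ LinearMap.range (matrixAction A N))) :=
    LinearMap.pi fun c => (LinearMap.range (matrixAction A N)).mkQ ∘ₗ
      (LinearMap.proj c : (κ → N) →ₗ[R] N).compLeft ι
  have hF : Function.Surjective F := by
    intro w
    choose u hu using fun c => Submodule.mkQ_surjective _ (w c)
    exact ⟨fun i c => u c i, funext fun c => hu c⟩
  have hker : LinearMap.ker F = LinearMap.range (matrixAction A (κ → N)) := by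
    ext v
    simp only [LinearMap.mem_ker, F, funext_iff, LinearMap.pi_apply, LinearMap.comp_apply,
      Submodule.mkQ_apply, Pi.zero_apply, Submodule.Quotient.mk_eq_zero, LinearMap.mem_range]
    constructor
    · intro h
      choose w hw using h
      exact ⟨fun i c => w c i, fun i c => by simpa using hw c i⟩
    · rintro ⟨w, hw⟩ c
      exact ⟨fun i => w i c, fun i => by simp [← hw]⟩
  rw [matrixLength, ← hker, (F.quotKerEquivOfSurjective hF).length_eq, Module.length_pi]
  simp [matrixLength]

theorem matrixLength_prod (A : Matrix ι ι R) :
    matrixLength A (N × Q) = matrixLength A N + matrixLength A Q := by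
  let F : (ι → N × Q) →ₗ[R] (((ι → N) ⧸ LinearMap.range (matrixAction A N)) ×
      ((ι → Q) ⧸ LinearMap.range (matrixAction A Q))) :=
    LinearMap.prod ((LinearMap.range (matrixAction A N)).mkQ ∘ₗ (LinearMap.fst R N Q).compLeft ι)
      ((LinearMap.range (matrixAction A Q)).mkQ ∘ₗ (LinearMap.snd R N Q).compLeft ι)
  have hF : Function.Surjective F := by
    rintro ⟨w₁, w₂⟩
    obtain ⟨u₁, rfl⟩ := Submodule.mkQ_surjective _ w₁
    obtain ⟨u₂, rfl⟩ := Submodule.mkQ_surjective _ w₂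
    exact ⟨fun i => (u₁ i, u₂ i), rfl⟩
  have hker : LinearMap.ker F = LinearMap.range (matrixAction A (N × Q)) := by
    ext v
    simp only [LinearMap.mem_ker, F, LinearMap.prod_apply, Function.prod_apply, LinearMap.comp_apply,
      Submodule.mkQ_apply, Prod.mk_eq_zero, Submodule.Quotient.mk_eq_zero, LinearMap.mem_range]
    constructor
    · rintro ⟨⟨w₁, h₁⟩, ⟨w₂, h₂⟩⟩
      refine ⟨fun i => (w₁ i, w₂ i), funext fun i => Prod.ext ?_ ?_⟩
      · simpa [Prod.fst_sum] using congrFun h₁ i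
      · simpa [Prod.snd_sum] using congrFun h₂ i
    · rintro ⟨w, rfl⟩
      exact ⟨⟨fun i => (w i).1, funext fun i => by simp [Prod.fst_sum]⟩,
        ⟨fun i => (w i).2, funext fun i => by simp [Prod.snd_sum]⟩⟩
  rw [matrixLength, ← hker, (F.quotKerEquivOfSurjective hF).length_eq, Module.length_prod]
  rfl

/-- `A` maps `(I ^ k) ^ ι` onto `(I ^ (k + 1)) ^ ι` for all `k ≥ k₀`; the matrix analogue of an
element generating a reduction of `I`. -/
def IsMatrixReduction (I : Ideal R) (A : Matrix ι ι R) (k₀ : ℕ) : Prop :=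
  (∀ i j, A i j ∈ I) ∧ ∀ k ≥ k₀, ∀ v : ι → R, (∀ i, v i ∈ I ^ (k + 1)) →
    ∃ w : ι → R, (∀ i, w i ∈ I ^ k) ∧ matrixAction A R w = v

theorem matrixAction_mem {I : Ideal R} {A : Matrix ι ι R} (hA : ∀ i j, A i j ∈ I) {k : ℕ}
    {v : ι → N} (hv : ∀ i, v i ∈ (I ^ k • ⊤ : Submodule R N)) (i : ι) :
    matrixAction A N v i ∈ (I ^ (k + 1) • ⊤ : Submodule R N) := by
  rw [matrixAction_apply]
  refine Submodule.sum_mem _ fun j _ => ?_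
  rw [pow_succ', mul_smul]
  exact Submodule.smul_mem_smul (hA i j) (hv j)

/-- The reduction property passes from R to every module: solve for a ∈ I^(k+1) in one coordinate
over R, multiply the solution by n, and add up. -/
theorem IsMatrixReduction.exists_eq [DecidableEq ι] {I : Ideal R} {A : Matrix ι ι R} {k₀ k : ℕ}
    (hA : IsMatrixReduction I A k₀) (hk : k₀ ≤ k) (v : ι → N)
    (hv : ∀ i, v i ∈ (I ^ (k + 1) • ⊤ : Submodule R N)) :
    ∃ w : ι → N, (∀ i, w i ∈ (I ^ k • ⊤ : Submodule R N)) ∧ matrixAction A N w = v := by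
  have key : ∀ (i : ι) (x : N), x ∈ (I ^ (k + 1) • ⊤ : Submodule R N) →
      ∃ w : ι → N, (∀ i, w i ∈ (I ^ k • ⊤ : Submodule R N)) ∧
        matrixAction A N w = Pi.single i x := by
    intro i x hx
    induction hx using Submodule.smul_induction_on' with
    | smul a ha n _ =>
      obtain ⟨w, hw, h⟩ := hA.2 k hk (Pi.single i a) (fun j => by
        by_cases hj : j = i
        · subst hj; simpa
        · simp [hj])
      refine ⟨fun j => w j • n, fun j => Submodule.smul_mem_smul (hw j) trivial, ?_⟩
      ext j
      have := congrArg (· • n) (congrFun h j)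
      simp only [matrixAction_apply, Finset.sum_smul, smul_eq_mul, mul_smul] at this
      rw [matrixAction_apply, this]
      by_cases hj : j = i
      · subst hj; simp
      · simp [hj]
    | add x _ y _ hx hy =>
      obtain ⟨w, hw, h⟩ := hx
      obtain ⟨w', hw', h'⟩ := hy
      exact ⟨w + w', fun j => add_mem (hw j) (hw' j), by rw [map_add, h, h', Pi.single_add]⟩
  choose w hw h using fun i => key i (v i) (hv i)
  refine ⟨∑ i, w i, fun j => ?_, ?_⟩
  · rw [Finset.sum_apply]
    exact Submodule.sum_mem _ fun i _ => hw i j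
  · rw [map_sum, Finset.sum_congr rfl fun i _ => h i]
    exact Finset.univ_sum_single v

/-- Solving for z^(k₀+1) times each basis vector yields B with A B = z^(k₀+1) • 1, so det A divides
a power of z. -/
theorem IsMatrixReduction.isRegular_det [DecidableEq ι] {I : Ideal R} {A : Matrix ι ι R} {k₀ : ℕ}
    (hA : IsMatrixReduction I A k₀) {z : R} (hz : z ∈ I) (hreg : IsRegular z) :
    IsRegular A.det := by
  choose w _ hw using fun i => hA.2 k₀ le_rfl (Pi.single i (z ^ (k₀ + 1))) (fun j => by
    by_cases hj : j = i
    · subst hj; simpa using Ideal.pow_mem_pow hz _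
    · simp [hj])
  have h : A * Matrix.of (fun i j => w j i) = z ^ (k₀ + 1) • (1 : Matrix ι ι R) := by
    ext i j
    have := congrFun (hw j) i
    simp only [matrixAction_apply, smul_eq_mul] at this
    rw [Matrix.mul_apply]
    simp [this, Pi.single_apply, Matrix.one_apply]
  have h2 := congrArg Matrix.det h
  rw [Matrix.det_mul, Matrix.det_smul, Matrix.det_one, mul_one] at h2
  have h3 : IsRegular (A.det * (Matrix.of (fun i j => w j i)).det) := h2 ▸ (hreg.pow _).pow _
  exact (isRegular_mul_iff.mp h3).1

end matrixAction

/-! ### Matrix length as a substitute for multiplicity -/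

section matrixLength

open IsLocalRing

variable {R : Type*} [CommRing R] {ι : Type*} [Fintype ι]
variable {N Q : Type*} [AddCommGroup N] [Module R N] [AddCommGroup Q] [Module R Q]

theorem matrixLength_eq_of_injective [DecidableEq ι] [Module.IsTorsionFree R Q] {A : Matrix ι ι R}
    (hA : IsRegular A.det) (j : N →ₗ[R] Q) (hj : Function.Injective j)
    (hfin : Module.length R (Q ⧸ LinearMap.range j) ≠ ⊤) :
    matrixLength A N = matrixLength A Q := by
  refine (length_quotient_range_eq_of_comm (j.compLeft ι) ?_ ?_ _ (matrixAction_injective A hA)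
    (matrixAction A N) (matrixAction_compLeft A j)).symm
  · exact hj.comp_left
  · let F : (ι → Q) →ₗ[R] (ι → Q ⧸ LinearMap.range j) := (LinearMap.range j).mkQ.compLeft ι
    have hF : Function.Surjective F := (Submodule.mkQ_surjective _).comp_left
    have hker : LinearMap.ker F = LinearMap.range (j.compLeft ι) := by
      ext v
      simp only [LinearMap.mem_ker, F, funext_iff, LinearMap.compLeft_apply, Function.comp_apply,
        Submodule.mkQ_apply, Pi.zero_apply, Submodule.Quotient.mk_eq_zero, LinearMap.mem_range]
      exact Classical.skolem
    rw [← hker, (F.quotKerEquivOfSurjective hF).length_eq, Module.length_pi]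
    exact WithTop.mul_ne_top (by rw [ENat.card_eq_coe_fintype_card]; exact ENat.natCast_ne_top _) hfin

variable [IsLocalRing R]

theorem length_quotient_pow_succ_smul [IsNoetherianRing R] [Module.Finite R N] (k : ℕ) :
    Module.length R (N ⧸ (maximalIdeal R ^ (k + 1) • ⊤ : Submodule R N)) =
      numGenerators R (maximalIdeal R ^ k • ⊤ : Submodule R N) +
        Module.length R (N ⧸ (maximalIdeal R ^ k • ⊤ : Submodule R N)) := by
  set P : Submodule R N := maximalIdeal R ^ k • ⊤
  have h := length_quotient_range_comp (maximalIdeal R • ⊤ : Submodule R P).subtype P.subtype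
    P.injective_subtype
  rw [LinearMap.range_comp, Submodule.range_subtype, Submodule.range_subtype, Submodule.map_smul'',
    Submodule.map_top, Submodule.range_subtype, length_quotient_maximalIdeal_smul] at h
  rw [pow_succ', mul_smul]
  exact h

theorem length_quotient_pow_smul_ne_top [IsNoetherianRing R] [Module.Finite R N] (k : ℕ) :
    Module.length R (N ⧸ (maximalIdeal R ^ k • ⊤ : Submodule R N)) ≠ ⊤ := by
  induction k with
  | zero =>
    have : Subsingleton (N ⧸ (maximalIdeal R ^ 0 • ⊤ : Submodule R N)) := by
      rw [Submodule.Quotient.subsingleton_iff]; simp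
    simp
  | succ k ih =>
    rw [length_quotient_pow_succ_smul]
    exact WithTop.add_ne_top.mpr ⟨ENat.natCast_ne_top _, ih⟩

/-- The entries of A lie in 𝔪, so the cokernel of A surjects onto (N/𝔪N)^ι. -/
theorem matrixLength_ge [Module.Finite R N] {A : Matrix ι ι R}
    (hA : ∀ i j, A i j ∈ maximalIdeal R) :
    (Fintype.card ι * numGenerators R N : ℕ) ≤ matrixLength A N := by
  let G := (maximalIdeal R • ⊤ : Submodule R N).mkQ.compLeft ι
  have hG : Function.Surjective G := (Submodule.mkQ_surjective _).comp_left
  have hle : LinearMap.range (matrixAction A N) ≤ LinearMap.ker G := by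
    rintro _ ⟨v, rfl⟩
    ext i
    simp only [G, LinearMap.compLeft_apply, Function.comp_apply, Submodule.mkQ_apply, Pi.zero_apply,
      Submodule.Quotient.mk_eq_zero]
    simpa using matrixAction_mem (k := 0) hA (v := v) (by simp) i
  have h := Module.length_le_of_surjective
    ((LinearMap.range (matrixAction A N)).liftQ G hle) (fun w => by
      obtain ⟨v, rfl⟩ := hG w
      exact ⟨Submodule.Quotient.mk v, rfl⟩)
  rw [Module.length_pi, length_quotient_maximalIdeal_smul] at h
  simpa [matrixLength] using h

variable [IsNoetherianRing R] {A : Matrix ι ι R} {k₀ : ℕ}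

/-- On 𝔪^k the image of A is all of (𝔪^(k+1))^ι, so the lower bound `matrixLength_ge` is attained.
-/
theorem IsMatrixReduction.matrixLength_pow (hA : IsMatrixReduction (maximalIdeal R) A k₀) {k : ℕ}
    (hk : k₀ ≤ k) :
    matrixLength A ↥(maximalIdeal R ^ k) =
      (Fintype.card ι * numGenerators R ↥(maximalIdeal R ^ k) : ℕ) := by
  refine (matrixLength_ge hA.1).antisymm' ?_
  let G := (maximalIdeal R • ⊤ : Submodule R ↥(maximalIdeal R ^ k)).mkQ.compLeft ι
  have hle : LinearMap.ker G ≤ LinearMap.range (matrixAction A ↥(maximalIdeal R ^ k)) := by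
    intro v hv
    have hv' : ∀ i, (v i : R) ∈ maximalIdeal R ^ (k + 1) := by
      intro i
      have h := congrFun hv i
      simp only [G, LinearMap.compLeft_apply, Function.comp_apply, Submodule.mkQ_apply,
        Pi.zero_apply, Submodule.Quotient.mk_eq_zero] at h
      rw [Submodule.mem_smul_top_iff] at h
      rwa [pow_succ']
    obtain ⟨w, hw, h⟩ := hA.2 k hk (fun i => v i) hv'
    refine ⟨fun i => ⟨w i, hw i⟩, ?_⟩
    ext i
    simpa using congrFun h i
  have h := Module.length_le_of_surjective (Submodule.factor hle) (Submodule.factor_surjective _)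
  refine h.trans ((Module.length_le_of_injective
    ((LinearMap.ker G).liftQ G le_rfl) ?_).trans ?_)
  · rw [← LinearMap.ker_eq_bot, Submodule.ker_liftQ_eq_bot _ _ _ le_rfl]
  · rw [Module.length_pi, length_quotient_maximalIdeal_smul]
    simp

variable [DecidableEq ι] {z : R}

theorem IsMatrixReduction.matrixLength_self (hA : IsMatrixReduction (maximalIdeal R) A k₀)
    (hz : z ∈ maximalIdeal R) (hreg : IsRegular z) {k : ℕ} (hk : k₀ ≤ k) :
    matrixLength A R = (Fintype.card ι * numGenerators R ↥(maximalIdeal R ^ k) : ℕ) := by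
  rw [← hA.matrixLength_pow hk]
  refine (matrixLength_eq_of_injective (hA.isRegular_det hz hreg) (maximalIdeal R ^ k).subtype
    (Submodule.injective_subtype _) ?_).symm
  have := length_quotient_pow_smul_ne_top (R := R) (N := R) k
  rwa [smul_eq_mul, Ideal.mul_top, ← Submodule.range_subtype (maximalIdeal R ^ k)] at this

/-- P is enlarged to P₁ = P + 𝔪^k Q, which has finite colength and hence the same matrix length as
Q. By Artin–Rees, for large k the cokernel of A on P injects into the one on P₁. -/
theorem IsMatrixReduction.matrixLength_le [Module.Finite R Q] [Module.IsTorsionFree R Q]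
    (hA : IsMatrixReduction (maximalIdeal R) A k₀)
    (hz : z ∈ maximalIdeal R) (hreg : IsRegular z) (P : Submodule R Q) :
    matrixLength A P ≤ matrixLength A Q := by
  obtain ⟨c, hc⟩ := (maximalIdeal R).exists_pow_inf_eq_pow_smul P
  set k := c + k₀
  have hAR : (maximalIdeal R ^ (k + 1) • ⊤ ⊓ P : Submodule R Q) ≤ maximalIdeal R ^ (k₀ + 1) • P := by
    rw [hc (k + 1) (by omega), show k + 1 - c = k₀ + 1 by omega]
    exact smul_mono_right _ inf_le_right
  set P₁ : Submodule R Q := P ⊔ maximalIdeal R ^ k • ⊤ with hP₁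
  have hle : P ≤ P₁ := le_sup_left
  have hcolen : matrixLength A P₁ = matrixLength A Q := by
    refine matrixLength_eq_of_injective (hA.isRegular_det hz hreg) P₁.subtype
      P₁.injective_subtype (ne_top_of_le_ne_top (length_quotient_pow_smul_ne_top (R := R) (N := Q) k) ?_)
    rw [Submodule.range_subtype]
    exact Module.length_le_of_surjective
      (Submodule.factor (le_sup_right : maximalIdeal R ^ k • ⊤ ≤ P₁)) (Submodule.factor_surjective _)
  rw [← hcolen]
  refine Module.length_le_of_injective (Submodule.mapQ _ _ ((Submodule.inclusion hle).compLeft ι) ?_)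
    ?_
  · rintro _ ⟨v, rfl⟩
    exact ⟨(Submodule.inclusion hle).compLeft ι v,
      LinearMap.congr_fun (matrixAction_compLeft A (Submodule.inclusion hle)) v⟩
  rw [← LinearMap.ker_eq_bot, Submodule.ker_mapQ, ← le_bot_iff, Submodule.map_le_iff_le_comap, ← LinearMap.ker,
    Submodule.ker_mkQ]
  rintro v ⟨w, hw⟩
  have hw' : ∀ i, ∑ j, A i j • (w j : Q) = v i := fun i => by
    simpa using congrArg Subtype.val (congrFun hw i)
  choose p hp e he hpe using fun i => Submodule.mem_sup.mp (w i).2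
  -- Writing w = p + e with p in P and e in 𝔪^k Q, the vector A e = v - A p lies in both 𝔪^(k+1) Q
  -- and P, hence in 𝔪^(k₀+1) P. There A can be solved inside P.
  have hmem : ∀ i, ∑ j, A i j • e j ∈ (maximalIdeal R ^ (k₀ + 1) • P : Submodule R Q) := by
    intro i
    refine hAR ⟨by simpa using matrixAction_mem hA.1 he i, ?_⟩
    have : ∑ j, A i j • e j = v i - ∑ j, A i j • p j := by
      rw [← hw' i, ← Finset.sum_sub_distrib]
      exact Finset.sum_congr rfl fun j _ => by rw [← hpe j, smul_add, add_sub_cancel_left]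
    rw [this]
    exact P.sub_mem (v i).2 (P.sum_mem fun j _ => P.smul_mem _ (hp j))
  have hmem' : ∀ i, ∃ u : P, u ∈ (maximalIdeal R ^ (k₀ + 1) • ⊤ : Submodule R P) ∧
      (u : Q) = ∑ j, A i j • e j := fun i =>
    ⟨⟨_, Submodule.smul_le_right (hmem i)⟩, (Submodule.mem_smul_top_iff _ _ _).mpr (hmem i), rfl⟩
  choose u hu hue using hmem'
  obtain ⟨t, -, ht⟩ := hA.exists_eq le_rfl u hu
  refine ⟨(fun j => ⟨p j, hp j⟩) + t, ?_⟩
  rw [map_add, ht]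
  ext i
  simp [hue, ← hw' i, ← hpe, Finset.sum_add_distrib]

/-- If `N × R ^ r` embeds into `R ^ n` and `e` is the eventual value of the number of generators of
the powers of the maximal ideal, then `N` has at most `(n - r) e` generators. -/
theorem IsMatrixReduction.numGenerators_add_le (hA : IsMatrixReduction (maximalIdeal R) A k₀)
    [Nonempty ι] (hz : z ∈ maximalIdeal R) (hreg : IsRegular z) {k : ℕ} (hk : k₀ ≤ k)
    [Module.Finite R N] {r n : ℕ} (f : (N × (Fin r → R)) →ₗ[R] (Fin n → R))
    (hf : Function.Injective f) :
    numGenerators R N + r * numGenerators R ↥(maximalIdeal R ^ k) ≤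
      n * numGenerators R ↥(maximalIdeal R ^ k) := by
  have h := hA.matrixLength_le hz hreg (LinearMap.range f)
  rw [← (LinearEquiv.ofInjective f hf).matrixLength_eq, matrixLength_prod, matrixLength_pi,
    matrixLength_pi, hA.matrixLength_self hz hreg hk] at h
  have h' := (add_le_add_left (matrixLength_ge (N := N) hA.1) _).trans h
  rw [Fintype.card_fin, Fintype.card_fin] at h'
  norm_cast at h'
  have hpos : 0 < Fintype.card ι := Fintype.card_pos
  nlinarith

end matrixLength

/-! ### An Eakin–Sathaye argument along the moment curve -/

section genericReduction

variable {S : Type*} [CommRing S] {V : Type*} [AddCommGroup V] [Module S V]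

theorem Submodule.length_add_one_le {P Q : Submodule S V} (h : P < Q) :
    Module.length S P + 1 ≤ Module.length S Q := by
  rw [Module.length_submodule, Module.length_submodule]
  exact Order.height_add_one_le h

theorem Submodule.eq_of_le_of_length_le {P Q : Submodule S V} (h : P ≤ Q)
    (hl : Module.length S Q ≤ Module.length S P) (hfin : Module.length S Q ≠ ⊤) : P = Q := by
  by_contra hne
  have h1 := (Submodule.length_add_one_le (lt_of_le_of_ne h hne)).trans hl
  have h2 : Module.length S P ≠ ⊤ := ne_top_of_le_ne_top hfin (le_self_add.trans
    (Submodule.length_add_one_le (lt_of_le_of_ne h hne)))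
  exact (ENat.add_one_le_iff h2).mp h1 |>.false

/-- The point with parameter `t` on the moment curve with coefficients `x`. -/
def momentCurve {g : ℕ} (x : Fin g → S) (t : S) : S := ∑ i : Fin g, t ^ (i : ℕ) * x i

variable {g : ℕ} (x : Fin g → S)

theorem momentCurve_mem (t : S) : momentCurve x t ∈ Ideal.span (Set.range x) :=
  Ideal.sum_mem _ fun i _ => Ideal.mul_mem_left _ _ (Ideal.subset_span ⟨i, rfl⟩)

/-- The coefficients are recovered from g points of the curve by inverting a Vandermonde matrix,
whose determinant is a product of unit differences. -/
theorem span_range_le_span_momentCurve (T : Finset S) (hT : g ≤ T.card)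
    (hunit : ∀ s ∈ T, ∀ t ∈ T, s ≠ t → IsUnit (s - t)) :
    Ideal.span (Set.range x) ≤ Ideal.span (momentCurve x '' T) := by
  obtain ⟨T', hT', hcard⟩ := Finset.exists_subset_card_eq hT
  let v : Fin g → S := fun i => ((T'.equivFinOfCardEq hcard).symm i : S)
  have hv : ∀ i, v i ∈ T := fun i => hT' ((T'.equivFinOfCardEq hcard).symm i).2
  have hinj : Function.Injective v :=
    Subtype.val_injective.comp (T'.equivFinOfCardEq hcard).symm.injective
  have hdet : IsUnit (Matrix.vandermonde v).det := by
    rw [Matrix.det_vandermonde]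
    refine IsUnit.prod_univ_iff.mpr fun i => IsUnit.prod_iff.mpr fun j hj => ?_
    exact hunit _ (hv j) _ (hv i) fun h => (Finset.mem_Ioi.mp hj).ne' (hinj h)
  have hx : x = (Matrix.vandermonde v)⁻¹.mulVec fun i => momentCurve x (v i) := by
    have : (fun i => momentCurve x (v i)) = (Matrix.vandermonde v).mulVec x := by
      ext i
      simp [momentCurve, Matrix.mulVec, dotProduct]
    rw [this, Matrix.mulVec_mulVec, Matrix.nonsing_inv_mul _ hdet, Matrix.one_mulVec]
  rw [Ideal.span_le]
  rintro _ ⟨i, rfl⟩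
  rw [SetLike.mem_coe, congrFun hx i, Matrix.mulVec, dotProduct]
  exact Ideal.sum_mem _ fun j _ => Ideal.mul_mem_left _ _ (Ideal.subset_span (Set.mem_image_of_mem _ (hv j)))

/-- A rank one Eakin–Sathaye theorem with explicit bounds: if sufficiently many points of the moment
curve fail to generate `I ^ (n + 1) • W` from `I ^ n • W`, then `I ^ (n + 1) • W` has length at
least `n + 2`. -/
theorem length_ge_of_momentCurve (n : ℕ) (T : Finset S) (hT : (n + 1) * g + 1 ≤ T.card)
    (hunit : ∀ s ∈ T, ∀ t ∈ T, s ≠ t → IsUnit (s - t)) (W : Submodule S V)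
    (h : ∀ t ∈ T, Ideal.span {momentCurve x t} • Ideal.span (Set.range x) ^ n • W ≠
      Ideal.span (Set.range x) ^ (n + 1) • W) :
    (n + 2 : ℕ) ≤ Module.length S ↥(Ideal.span (Set.range x) ^ (n + 1) • W) := by
  classical
  set I := Ideal.span (Set.range x) with hI
  set y : S → Ideal S := fun t => Ideal.span {momentCurve x t} with hy
  have hyI : ∀ t, y t ≤ I := fun t => by
    simpa [hy, Ideal.span_le] using momentCurve_mem x t
  have hlt : ∀ {n : ℕ} {W : Submodule S V} {t : S}, y t • I ^ n • W ≠ I ^ (n + 1) • W →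
      y t • I ^ n • W < I ^ (n + 1) • W := fun {n W t} h => by
    refine lt_of_le_of_ne ?_ h
    rw [pow_succ', mul_smul]
    exact Submodule.smul_mono_left (hyI t)
  have hspan : ∀ (T' : Finset S), T' ⊆ T → g ≤ T'.card → ∀ (P Q : Submodule S V),
      (∀ t ∈ T', y t • P ≤ Q) → I • P ≤ Q := by
    intro T' hsub hcard P Q hPQ
    refine (Submodule.smul_mono_left (span_range_le_span_momentCurve x T' hcard
      fun s hs t ht => hunit s (hsub hs) t (hsub ht))).trans ?_
    rw [← Set.biUnion_of_singleton (momentCurve x '' T'), Ideal.span, Submodule.span_iUnion₂]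
    simp only [Submodule.iSup_smul, iSup_le_iff]
    rintro _ ⟨t, ht, rfl⟩
    exact hPQ t ht
  induction n generalizing T W with
  | zero =>
    obtain ⟨t₀, ht₀⟩ : T.Nonempty := Finset.card_pos.mp (by omega)
    by_contra hlen
    push Not at hlen
    -- Here I • W has length at most 1, so its proper submodules y t • W vanish; as the points
    -- generate I, so does I • W.
    have hzero : ∀ t ∈ T, y t • W ≤ ⊥ := by
      intro t ht
      have h1 := Submodule.length_add_one_le (hlt (h t ht))
      have h2 : Module.length S ↥(y t • I ^ 0 • W) = 0 := by
        have h3 : Module.length S ↥(y t • I ^ 0 • W) + 1 < 1 + 1 := h1.trans_lt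
          (by simpa [one_add_one_eq_two] using hlen)
        exact Order.lt_one_iff.mp (lt_of_add_lt_add_right h3)
      rw [Module.length_eq_zero_iff, Submodule.subsingleton_iff_eq_bot] at h2
      simpa using h2.le
    have hbot := hspan T subset_rfl (by omega) W ⊥ hzero
    refine h t₀ ht₀ ?_
    rw [zero_add, pow_one, le_bot_iff.mp hbot]
    simpa using le_bot_iff.mp (hzero t₀ ht₀)
  | succ n ih =>
    by_contra hlen
    push Not at hlen
    have hfin : Module.length S ↥(I ^ (n + 1 + 1) • W) ≠ ⊤ := hlen.ne_top
    have hcomm : ∀ (s t : S) (k : ℕ), y s • I ^ k • y t • W = y s • y t • I ^ k • W := by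
      intro s t k
      simp only [← mul_smul]
      congr 2
      exact mul_comm _ _
    -- Too many bad s would, by induction applied to y t • W, give y t • I ^ (n + 1) • W length at
    -- least n + 2. It is properly contained in I ^ (n + 2) • W, whose length would then be too
    -- large.
    have hfew : ∀ t ∈ T, (T.filter fun s => y s • I ^ n • y t • W ≠
        I ^ (n + 1) • y t • W).card ≤ (n + 1) * g := by
      intro t ht
      by_contra hcard
      have h1 := ih (T.filter fun s => y s • I ^ n • y t • W ≠ I ^ (n + 1) • y t • W)
        (by omega) (fun a ha b hb => hunit a (Finset.filter_subset _ _ ha) b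
          (Finset.filter_subset _ _ hb)) (y t • W) (fun s hs => (Finset.mem_filter.mp hs).2)
        (fun T' hT' => hspan T' (hT'.trans (Finset.filter_subset _ _)))
      have h2 := Submodule.length_add_one_le (hlt (h t ht))
      rw [show I ^ (n + 1) • y t • W = y t • I ^ (n + 1) • W by
        simp only [← mul_smul]; congr 1; exact mul_comm _ _] at h1
      have h3 := (add_le_add_left h1 1).trans h2
      exact absurd h3 (not_le.mpr (by exact_mod_cast hlen))
    obtain ⟨t₀, ht₀⟩ : T.Nonempty := Finset.card_pos.mp (by omega)
    -- For this t at least g values s are good, and each gives y t • I ^ (n + 1) • W ≤ y s • I ^ (n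
    -- + 1) • W. Maximality makes these equal, so the g good points, which generate I, show that t
    -- does not fail.
    obtain ⟨t, ht, hmax⟩ := T.exists_max_image
      (fun t => Module.length S ↥(y t • I ^ (n + 1) • W)) ⟨t₀, ht₀⟩
    have hcardT := T.card_filter_add_card_filter_not (fun s => y s • I ^ n • y t • W ≠
        I ^ (n + 1) • y t • W)
    have := hfew t ht
    have hge : g ≤ (T.filter fun s => ¬ y s • I ^ n • y t • W ≠ I ^ (n + 1) • y t • W).card := by
      have : (n + 1 + 1) * g = (n + 1) * g + g := by ring
      omega
    refine (hlt (h t ht)).not_ge ?_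
    have : I ^ (n + 1 + 1) • W = I • I ^ (n + 1) • W := by rw [← mul_smul, ← pow_succ']
    rw [this]
    refine hspan _ (Finset.filter_subset _ _) hge _ _ fun s hs => ?_
    obtain ⟨hsT, hs⟩ := Finset.mem_filter.mp hs
    rw [not_ne_iff] at hs
    have hle : y t • I ^ (n + 1) • W ≤ y s • I ^ (n + 1) • W := by
      have : y t • I ^ (n + 1) • W = y s • y t • I ^ n • W := by
        rw [← hcomm, hs]
        simp only [← mul_smul]; congr 1; exact mul_comm _ _
      rw [this, pow_succ', mul_smul]
      exact smul_mono_right _ (Submodule.smul_mono_left (hyI t))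
    refine (Submodule.eq_of_le_of_length_le hle (hmax s hsT) ?_).ge
    exact ne_top_of_le_ne_top hfin (le_self_add.trans (Submodule.length_add_one_le
      (hlt (h s hsT))))

end genericReduction

/-! ### Existence of a matrix reduction -/

section existence

open IsLocalRing

variable {R : Type*} [CommRing R] {S : Type*} [CommRing S] [Algebra R S]

theorem Module.Basis.mem_map_iff {ι : Type*} [Finite ι] (b : Module.Basis ι R S) (I : Ideal R)
    (s : S) : s ∈ I.map (algebraMap R S) ↔ ∀ i, b.repr s i ∈ I := by
  have := Fintype.ofFinite ι
  constructor
  · intro hs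
    induction hs using Submodule.span_induction with
    | mem x hx =>
      obtain ⟨a, ha, rfl⟩ := hx
      intro i
      rw [Algebra.algebraMap_eq_smul_one, map_smul]
      exact I.mul_mem_right _ ha
    | zero => simp
    | add x y _ _ hx hy => exact fun i => by rw [map_add]; exact I.add_mem (hx i) (hy i)
    | smul c x _ hx =>
      intro i
      rw [smul_eq_mul, ← b.sum_repr x, Finset.mul_sum, map_sum, Finsupp.finsetSum_apply]
      refine I.sum_mem fun j _ => ?_
      rw [mul_smul_comm, map_smul]
      exact I.mul_mem_right _ (hx j)
  · intro h
    rw [← b.sum_repr s]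
    refine Ideal.sum_mem _ fun i _ => ?_
    rw [Algebra.smul_def]
    exact Ideal.mul_mem_right _ _ (Ideal.mem_map_of_mem _ (h i))

/-- Coordinates in the basis identify I^k S with (I^k)^ι, and multiplication by y with the matrix.
-/
theorem isMatrixReduction_leftMulMatrix {ι : Type*} [Fintype ι] [DecidableEq ι]
    (b : Module.Basis ι R S) {I : Ideal R} {y : S} (hy : y ∈ I.map (algebraMap R S)) {k₀ : ℕ}
    (h : I.map (algebraMap R S) ^ (k₀ + 1) ≤ Ideal.span {y} * I.map (algebraMap R S) ^ k₀) :
    IsMatrixReduction I (Algebra.leftMulMatrix b y) k₀ := by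
  refine ⟨fun i j => ?_, fun k hk v hv => ?_⟩
  · rw [Algebra.leftMulMatrix_eq_repr_mul]
    exact (b.mem_map_iff I _).mp (Ideal.mul_mem_right _ _ hy) i
  · have hk' : I.map (algebraMap R S) ^ (k + 1) ≤ Ideal.span {y} * I.map (algebraMap R S) ^ k := by
      obtain ⟨t, rfl⟩ := Nat.exists_eq_add_of_le hk
      rw [show k₀ + t + 1 = k₀ + 1 + t by ring, pow_add _ (k₀ + 1) t, pow_add _ k₀ t,
        ← mul_assoc]
      exact Ideal.mul_mono_left h
    have hs : b.equivFun.symm v ∈ I.map (algebraMap R S) ^ (k + 1) := by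
      rw [← Ideal.map_pow, b.mem_map_iff]
      intro i
      rw [← b.equivFun_apply, LinearEquiv.apply_symm_apply]
      exact hv i
    obtain ⟨w, hw, hwv⟩ := Ideal.mem_span_singleton_mul.mp (hk' hs)
    rw [← Ideal.map_pow, b.mem_map_iff] at hw
    refine ⟨b.repr w, hw, ?_⟩
    have := Algebra.leftMulMatrix_mulVec_repr b y w
    rw [hwv] at this
    ext i
    have h2 := congrFun this i
    rw [← Module.Basis.equivFun_apply b (b.equivFun.symm v), LinearEquiv.apply_symm_apply] at h2
    simpa [Matrix.mulVec, dotProduct] using h2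

/-- The span is a quotient of (S/n)^c, because n kills its generators. -/
theorem length_span_le_card {V : Type*} [AddCommGroup V] [Module S V] {n : Ideal S} [n.IsMaximal]
    {c : ℕ} (u : Fin c → V) (hu : ∀ a ∈ n, ∀ i, a • u i = 0) :
    Module.length S ↥(Submodule.span S (Set.range u)) ≤ c := by
  let L := Fintype.linearCombination S u
  let G : (Fin c → S) →ₗ[S] (Fin c → S ⧸ n) := (Submodule.mkQ n).compLeft (Fin c)
  have hG : Function.Surjective G := (Submodule.mkQ_surjective _).comp_left
  have hle : LinearMap.ker G ≤ LinearMap.ker L := by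
    intro v hv
    have hv' : ∀ i, v i ∈ n := fun i =>
      (Submodule.Quotient.mk_eq_zero _).mp (congrFun hv i)
    simp only [L, LinearMap.mem_ker, Fintype.linearCombination_apply]
    exact Finset.sum_eq_zero fun i _ => hu _ (hv' i) i
  have h1 : Module.length S (S ⧸ n) = 1 :=
    Module.length_eq_one_iff.mpr (isSimpleModule_iff_isCoatom.mpr (Ideal.isMaximal_def.mp ‹_›))
  rw [← Fintype.range_linearCombination S u, ← L.quotKerEquivRange.length_eq]
  refine (Module.length_le_of_surjective (Submodule.factor hle)
    (Submodule.factor_surjective _)).trans ?_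
  rw [(G.quotKerEquivOfSurjective hG).length_eq, Module.length_pi, h1]
  simp

/-- In S/n^(c+2) the image of n^(c+1) is killed by n and has c generators, so its length is at most
c. Failure at every point of the moment curve would force length at least c + 2. Success modulo
n^(c+2) lifts by Nakayama. -/
theorem exists_pow_succ_le_of_card {n : Ideal S} [n.IsMaximal] (hn : n ≤ Ideal.jacobson ⊥) {g : ℕ}
    (x : Fin g → S) (hx : Ideal.span (Set.range x) = n) {c : ℕ} (a : Fin c → S)
    (ha : Ideal.span (Set.range a) = n ^ (c + 1)) (T : Finset S) (hT : (c + 1) * g + 1 ≤ T.card)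
    (hunit : ∀ s ∈ T, ∀ t ∈ T, s ≠ t → IsUnit (s - t)) :
    ∃ y ∈ n, n ^ (c + 1) ≤ Ideal.span {y} * n ^ c := by
  classical
  by_contra! hcon
  have hmap : ∀ J : Ideal S, (J • ⊤ : Submodule S (S ⧸ n ^ (c + 2))) =
      Submodule.map (Submodule.mkQ (n ^ (c + 2))) J := by
    intro J
    rw [← Submodule.range_mkQ (n ^ (c + 2)), ← Submodule.map_top, ← Submodule.map_smul'',
      smul_eq_mul, Ideal.mul_top]
  have key := length_ge_of_momentCurve x c T hT hunit (V := S ⧸ n ^ (c + 2)) ⊤ ?_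
  · rw [hx, hmap, ← ha, Ideal.span, Submodule.map_span, ← Set.range_comp] at key
    have h2 := key.trans (length_span_le_card (n := n) _ fun b hb i => ?_)
    · have : c + 2 ≤ c := by exact_mod_cast h2
      omega
    · rw [Function.comp_apply, ← map_smul, Submodule.mkQ_apply, Submodule.Quotient.mk_eq_zero,
        pow_succ']
      exact Ideal.mul_mem_mul hb (ha ▸ Ideal.subset_span ⟨i, rfl⟩)
  · intro t ht heq
    rw [hx, ← mul_smul, hmap, hmap] at heq
    refine hcon _ (hx ▸ momentCurve_mem x t) ?_
    refine Submodule.le_of_le_smul_of_le_jacobson_bot (I := n) ⟨Finset.univ.image a, ?_⟩ hn ?_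
    · rw [← ha]; simp
    · have h3 := Submodule.comap_mono (f := Submodule.mkQ (n ^ (c + 2))) heq.ge
      rw [Submodule.comap_map_eq, Submodule.comap_map_eq, Submodule.ker_mkQ] at h3
      rw [smul_eq_mul, ← pow_succ']
      exact le_sup_left.trans h3

open Polynomial in
/-- Over a local ring there are finite free local extensions with arbitrarily many elements whose
pairwise differences are units. -/
theorem exists_adjoinRoot_units [IsLocalRing R] (B : ℕ) :
    ∃ h : R[X], h.Monic ∧ ((maximalIdeal R).map (algebraMap R (AdjoinRoot h))).IsMaximal ∧
      (maximalIdeal R).map (algebraMap R (AdjoinRoot h)) ≤ Ideal.jacobson ⊥ ∧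
      ∃ T : Finset (AdjoinRoot h), B ≤ T.card ∧ ∀ s ∈ T, ∀ t ∈ T, s ≠ t → IsUnit (s - t) := by
  classical
  set k := ResidueField R
  -- At a root α of G + 1 one has G(α) = -1, so α and all α^m - 1 with 1 ≤ m ≤ B are nonzero. Hence
  -- the powers α^i with i < B are distinct in the residue field of the extension.
  let G : k[X] := X * ∏ m ∈ Finset.Icc 1 B, (X ^ m - 1)
  have hGm : (∏ m ∈ Finset.Icc 1 B, (X ^ m - 1 : k[X])).Monic :=
    monic_prod_of_monic _ _ fun m hm => by
      have := monic_X_pow_sub_C (1 : k) (n := m) (by have := Finset.mem_Icc.mp hm; omega)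
      simpa using this
  have hF : ¬ IsUnit (G + 1) := by
    refine not_isUnit_of_natDegree_pos _ ?_
    rw [← C_1, natDegree_add_C, natDegree_X_mul hGm.ne_zero]
    omega
  obtain ⟨p, hpm, hpi, hpF⟩ := exists_monic_irreducible_factor _ hF
  obtain ⟨h, hhp, -, hm⟩ := lifts_and_natDegree_eq_and_monic (f := residue R)
    ((mem_lifts _).mpr (map_surjective _ residue_surjective p)) hpm
  have := hm.finite_adjoinRoot
  set n := (maximalIdeal R).map (algebraMap R (AdjoinRoot h)) with hn
  have hmax : n.IsMaximal := by
    have h1 : (Ideal.span {h.map (Ideal.Quotient.mk (maximalIdeal R))}).IsMaximal := by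
      change (Ideal.span {h.map (residue R)}).IsMaximal
      rw [hhp]; exact PrincipalIdealRing.isMaximal_of_irreducible hpi
    refine Ideal.Quotient.maximal_of_isField _ ?_
    exact MulEquiv.isField ((Ideal.Quotient.maximal_ideal_iff_isField_quotient _).mp h1)
      (AdjoinRoot.quotAdjoinRootEquivQuotPolynomialQuot (maximalIdeal R) h).toMulEquiv
  -- By integrality every maximal ideal lies over 𝔪, so the maximal ideal n is the only one.
  have hle : ∀ M : Ideal (AdjoinRoot h), M.IsMaximal → n ≤ M := by
    intro M hM
    have := Ideal.isMaximal_comap_of_isIntegral_of_isMaximal (R := R) M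
    rw [hn, Ideal.map_le_iff_le_comap, IsLocalRing.eq_maximalIdeal this]
  have hunit : ∀ s : AdjoinRoot h, s ∉ n → IsUnit s := by
    intro s hs
    by_contra hs'
    obtain ⟨M, hM, hsM⟩ := exists_max_ideal_of_mem_nonunits hs'
    rw [← hmax.eq_of_le hM.ne_top (hle M hM)] at hsM
    exact hs hsM
  refine ⟨h, hm, hmax, le_sInf fun M hM => hle M hM.2, ?_⟩
  let α : AdjoinRoot h ⧸ n := Ideal.Quotient.mk n (AdjoinRoot.root h)
  let ψ : k →+* AdjoinRoot h ⧸ n := Ideal.Quotient.lift _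
    ((Ideal.Quotient.mk n).comp (algebraMap R (AdjoinRoot h))) fun a ha =>
      Ideal.Quotient.eq_zero_iff_mem.mpr (Ideal.mem_map_of_mem _ ha)
  have hp0 : p.eval₂ ψ α = 0 := by
    rw [← hhp, eval₂_map]
    have : ψ.comp (residue R) =
      (Ideal.Quotient.mk n).comp (algebraMap R (AdjoinRoot h)) := Ideal.Quotient.lift_comp_mk _ _ _
    rw [this, ← hom_eval₂]
    have : eval₂ (algebraMap R (AdjoinRoot h)) (AdjoinRoot.root h) h = 0 := AdjoinRoot.eval₂_root h
    rw [this, map_zero]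
  have hG : α * ∏ m ∈ Finset.Icc 1 B, (α ^ m - 1) = -1 := by
    obtain ⟨q, hq⟩ := hpF
    have h1 : (G + 1).eval₂ ψ α = 0 := by rw [hq, eval₂_mul, hp0, zero_mul]
    have h2 : G.eval₂ ψ α = α * ∏ m ∈ Finset.Icc 1 B, (α ^ m - 1) := by
      simp [G, eval₂_mul, eval₂_finsetProd]
    rw [← h2]
    exact eq_neg_of_add_eq_zero_left (by simpa using h1)
  have hαu : IsUnit (α * ∏ m ∈ Finset.Icc 1 B, (α ^ m - 1)) := by rw [hG]; exact isUnit_one.neg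
  have hnt : Nontrivial (AdjoinRoot h ⧸ n) := Ideal.Quotient.nontrivial_iff.mpr hmax.ne_top
  have hmem : ∀ s : AdjoinRoot h, IsUnit (Ideal.Quotient.mk n s) → IsUnit s := fun s hs =>
    hunit s fun hsn => hs.ne_zero (Ideal.Quotient.eq_zero_iff_mem.mpr hsn)
  have hroot : IsUnit (AdjoinRoot.root h) := hmem _ (isUnit_of_mul_isUnit_left hαu)
  have hpow : ∀ m ∈ Finset.Icc 1 B, IsUnit (AdjoinRoot.root h ^ m - 1) := fun m hm => hmem _ (by
    simpa using IsUnit.prod_iff.mp (isUnit_of_mul_isUnit_right hαu) m hm)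
  have hdiff : ∀ i < B, ∀ j < i, IsUnit (AdjoinRoot.root h ^ i - AdjoinRoot.root h ^ j) := by
    intro i hi j hj
    obtain ⟨d, rfl⟩ := Nat.exists_eq_add_of_lt hj
    have : AdjoinRoot.root h ^ (j + d + 1) - AdjoinRoot.root h ^ j =
      AdjoinRoot.root h ^ j * (AdjoinRoot.root h ^ (d + 1) - 1) := by ring
    rw [this]
    exact (hroot.pow j).mul (hpow _ (Finset.mem_Icc.mpr (by omega)))
  have hnt' : Nontrivial (AdjoinRoot h) := (Ideal.Quotient.mk n).domain_nontrivial
  refine ⟨(Finset.range B).image (AdjoinRoot.root h ^ ·), ?_, ?_⟩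
  · rw [Finset.card_image_of_injOn, Finset.card_range]
    intro i hi j hj hij
    simp only [Finset.coe_range, Set.mem_Iio] at hi hj
    by_contra hne
    rcases lt_or_gt_of_ne hne with hlt | hlt
    · exact (hdiff j hj i hlt).ne_zero (sub_eq_zero.mpr hij.symm)
    · exact (hdiff i hi j hlt).ne_zero (sub_eq_zero.mpr hij)
  · simp only [Finset.mem_image, Finset.mem_range]
    rintro _ ⟨i, hi, rfl⟩ _ ⟨j, hj, rfl⟩ hij
    rcases lt_trichotomy i j with hlt | rfl | hlt
    · rw [← neg_sub]; exact (hdiff j hj i hlt).neg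
    · exact absurd rfl hij
    · exact hdiff i hi j hlt

theorem exists_fin_span_eq [IsLocalRing R] [IsNoetherianRing R] (I : Ideal R) {c : ℕ}
    (hc : numGenerators R I ≤ c) : ∃ a : Fin c → R, Ideal.span (Set.range a) = I := by
  obtain ⟨f, hf⟩ := exists_surjective_of_numGenerators (R := R) (P := I)
  let a₀ : Fin (numGenerators R I) → R := fun i => f (Pi.single i 1)
  have ha₀ : ∀ v, (f v : R) = ∑ i, v i * a₀ i := fun v => by
    conv_lhs => rw [pi_eq_sum_univ' v]
    simp [a₀]
  refine ⟨fun i => if h : (i : ℕ) < numGenerators R I then a₀ ⟨i, h⟩ else 0, le_antisymm ?_ ?_⟩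
  · rw [Ideal.span_le]
    rintro _ ⟨i, rfl⟩
    dsimp only
    split_ifs
    · exact (f _).2
    · exact I.zero_mem
  · intro z hz
    obtain ⟨v, hv⟩ := hf ⟨z, hz⟩
    have : z = ∑ i, v i * a₀ i := by rw [← ha₀, hv]
    rw [this]
    refine Ideal.sum_mem _ fun i _ => Ideal.mul_mem_left _ _ (Ideal.subset_span
      ⟨⟨i, i.2.trans_le hc⟩, ?_⟩)
    simp

/-- A bound c on all ν(𝔪^k) applies in particular to 𝔪^(c+1), as the moment curve argument requires;
the extension supplies enough parameters whatever the residue field. -/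
theorem exists_isMatrixReduction [IsLocalRing R] [IsNoetherianRing R] {c : ℕ}
    (hc : ∀ k, numGenerators R ↥(maximalIdeal R ^ k) ≤ c) :
    ∃ (d : ℕ) (_ : 0 < d) (A : Matrix (Fin d) (Fin d) R) (k₀ : ℕ),
      IsMatrixReduction (maximalIdeal R) A k₀ := by
  obtain ⟨x, hx⟩ := exists_fin_span_eq (maximalIdeal R) (le_rfl)
  obtain ⟨a, ha⟩ := exists_fin_span_eq (maximalIdeal R ^ (c + 1)) (hc _)
  obtain ⟨h, hm, hmax, hjac, T, hT, hunit⟩ := exists_adjoinRoot_units (R := R)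
    ((c + 1) * numGenerators R (maximalIdeal R) + 1)
  have hrange : ∀ {m : ℕ} (u : Fin m → R), Set.range (fun i => algebraMap R (AdjoinRoot h) (u i)) =
      algebraMap R (AdjoinRoot h) '' Set.range u := fun u => Set.range_comp _ u
  obtain ⟨y, hy, hle⟩ := exists_pow_succ_le_of_card hjac
    (fun i => algebraMap R (AdjoinRoot h) (x i)) (by
      rw [hrange x, ← Ideal.map_span, hx])
    (fun i => algebraMap R (AdjoinRoot h) (a i)) (by
      rw [← Ideal.map_pow, hrange a, ← Ideal.map_span, ha]) T hT hunit
  let b := AdjoinRoot.powerBasisAux' hm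
  have : Nontrivial (AdjoinRoot h) := nontrivial_of_ne 0 1 fun h0 =>
    hmax.ne_top ((Ideal.eq_top_iff_one _).mpr (h0 ▸ Ideal.zero_mem _))
  refine ⟨h.natDegree, ?_, Algebra.leftMulMatrix b y, c, isMatrixReduction_leftMulMatrix b hy hle⟩
  exact Fin.pos_iff_nonempty.mpr b.index_nonempty

end existence

/-! ### Multiplicity as the eventual number of generators of powers of 𝔪 -/

section multiplicity

open IsLocalRing Filter Topology

variable {R : Type*} [CommRing R] [IsLocalRing R]

theorem maximalIdeal_notMem_minimalPrimes (hdim : ringKrullDim R = 1) :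
    maximalIdeal R ∉ minimalPrimes R := by
  intro h
  have h0 : Ring.KrullDimLE 0 R := Ring.KrullDimLE.mk₀ fun I hI => by
    have := h.2 ⟨hI, bot_le⟩ (le_maximalIdeal hI.ne_top)
    rw [le_antisymm (le_maximalIdeal hI.ne_top) this]
    infer_instance
  have := (Ring.krullDimLE_iff (n := 0) (R := R)).mp h0
  rw [hdim] at this
  exact absurd this (by decide)

theorem maximalIdeal_pow_ne_bot (hdim : ringKrullDim R = 1) (k : ℕ) : maximalIdeal R ^ k ≠ ⊥ := by
  intro h
  refine maximalIdeal_notMem_minimalPrimes hdim ⟨⟨inferInstance, bot_le⟩, fun p hp _ => ?_⟩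
  have := hp.1
  exact Ideal.IsPrime.le_of_pow_le (n := k) (by rw [h]; exact bot_le)

variable [IsNoetherianRing R]

/-- Prime avoidance gives x in 𝔪 outside all minimal primes, so R/xR is Artinian. Such an x may be a
zero divisor. -/
theorem exists_mem_maximalIdeal_length_ne_top (hdim : ringKrullDim R = 1) :
    ∃ x ∈ maximalIdeal R, Module.length R (R ⧸ Ideal.span {x}) ≠ ⊤ := by
  obtain ⟨x, hx, hx'⟩ : ∃ x ∈ maximalIdeal R, ∀ p ∈ minimalPrimes R, x ∉ p := by
    by_contra! hcon
    have hsub : (maximalIdeal R : Set R) ⊆ ⋃ p ∈ minimalPrimes R, (p : Set R) := fun x hx => by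
      obtain ⟨p, hp, hxp⟩ := hcon x hx
      exact Set.mem_biUnion hp hxp
    obtain ⟨p, hp, hle⟩ := (Ideal.subset_union_prime_finite (minimalPrimes.finite_of_isNoetherianRing R)
      (f := id) 0 0 fun _ h _ _ => h.1.1).mp hsub
    refine maximalIdeal_notMem_minimalPrimes hdim ?_
    rwa [le_antisymm hle (le_maximalIdeal hp.1.1.ne_top)]
  refine ⟨x, hx, ?_⟩
  have h1 : Ring.KrullDimLE 1 R := (Ring.krullDimLE_iff (n := 1) (R := R)).mpr hdim.le
  have h0 : Ring.KrullDimLE 0 (R ⧸ Ideal.span {x}) := Ring.KrullDimLE.mk₀ fun P hP => by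
    have hmem : x ∈ P.comap (Ideal.Quotient.mk (Ideal.span {x})) := by
      rw [Ideal.mem_comap, Ideal.Quotient.eq_zero_iff_mem.mpr (Ideal.mem_span_singleton_self x)]
      exact P.zero_mem
    rcases Ring.krullDimLE_one_iff.mp h1 _ (Ideal.comap_isPrime (Ideal.Quotient.mk _) P) with h | h
    · exact absurd hmem (hx' _ h)
    · rw [← Ideal.map_comap_of_surjective _ Ideal.Quotient.mk_surjective P]
      refine (Ideal.map_eq_top_or_isMaximal_of_surjective _ Ideal.Quotient.mk_surjective
        h).resolve_left ?_
      rw [Ideal.map_comap_of_surjective _ Ideal.Quotient.mk_surjective P]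
      exact hP.ne_top
  have : IsArtinianRing (R ⧸ Ideal.span {x}) :=
    isArtinianRing_iff_isNoetherianRing_krullDimLE_zero.mpr ⟨inferInstance, h0⟩
  rw [Module.length_eq_of_surjective (R := R ⧸ Ideal.span {x}) Ideal.Quotient.mk_surjective]
  exact Module.length_ne_top

/-- For a parameter x, ν(𝔪^k) ≤ length(𝔪^k / x𝔪^k) ≤ length(R/xR). -/
theorem exists_numGenerators_pow_le (hdim : ringKrullDim R = 1) :
    ∃ c, ∀ k, numGenerators R ↥(maximalIdeal R ^ k) ≤ c := by
  obtain ⟨x, hx, hfin⟩ := exists_mem_maximalIdeal_length_ne_top hdim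
  refine ⟨(Module.length R (R ⧸ Ideal.span {x})).toNat, fun k => ?_⟩
  rw [← Nat.cast_le (α := ℕ∞), ENat.natCast_toNat hfin, ← length_quotient_maximalIdeal_smul]
  have h1 : Module.length R (R ⧸ LinearMap.range (maximalIdeal R ^ k).subtype) ≠ ⊤ := by
    have := length_quotient_pow_smul_ne_top (R := R) (N := R) k
    rwa [smul_eq_mul, Ideal.mul_top, ← Submodule.range_subtype (maximalIdeal R ^ k)] at this
  have h2 := length_quotient_range_le_of_comm (maximalIdeal R ^ k).subtype
    (Submodule.injective_subtype _) h1 (LinearMap.lsmul R R x) (LinearMap.lsmul R _ x)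
    (by ext; simp)
  have h3 : LinearMap.range (LinearMap.lsmul R R x) = Ideal.span {x} := by
    ext z
    simp only [LinearMap.mem_range, LinearMap.lsmul_apply, smul_eq_mul,
      Ideal.mem_span_singleton', mul_comm x]
  rw [h3] at h2
  refine le_trans ?_ h2
  have hle : LinearMap.range (LinearMap.lsmul R ↥(maximalIdeal R ^ k) x) ≤ maximalIdeal R • ⊤ := by
    rintro _ ⟨v, rfl⟩
    exact Submodule.smul_mem_smul hx trivial
  exact Module.length_le_of_surjective (Submodule.factor hle) (Submodule.factor_surjective _)

theorem IsMatrixReduction.numGenerators_pow_succ_le {d : ℕ} (hd : 0 < d)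
    {A : Matrix (Fin d) (Fin d) R} {k₀ : ℕ} (hA : IsMatrixReduction (maximalIdeal R) A k₀) {k : ℕ}
    (hk : k₀ ≤ k) :
    numGenerators R ↥(maximalIdeal R ^ (k + 1)) ≤ numGenerators R ↥(maximalIdeal R ^ k) := by
  have hmem : ∀ (v : Fin d → ↥(maximalIdeal R ^ k)) (i : Fin d),
      matrixAction A R (fun j => (v j : R)) i ∈ maximalIdeal R ^ (k + 1) := fun v i => by
    simpa using matrixAction_mem (N := R) hA.1 (k := k) (v := fun j => (v j : R)) (by simp) i
  let F : (Fin d → ↥(maximalIdeal R ^ k)) →ₗ[R] (Fin d → ↥(maximalIdeal R ^ (k + 1))) :=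
    LinearMap.pi fun i => LinearMap.codRestrict _ (LinearMap.proj i ∘ₗ matrixAction A R ∘ₗ
      (maximalIdeal R ^ k).subtype.compLeft (Fin d)) fun v => hmem v i
  have hF : Function.Surjective F := fun v => by
    obtain ⟨w, hw, h⟩ := hA.2 k hk (fun i => v i) fun i => (v i).2
    exact ⟨fun i => ⟨w i, hw i⟩, funext fun i => Subtype.ext (congrFun h i)⟩
  have h := numGenerators_le_of_surjective F hF
  rw [numGenerators_pi, numGenerators_pi] at h
  exact Nat.le_of_mul_le_mul_left h hd

/-- The increments of length(R/𝔪^n) are ν(𝔪^n), so the length is eventually affine in n with slope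
e. -/
theorem tendsto_length_quotient_pow {e K : ℕ}
    (h : ∀ k ≥ K, numGenerators R ↥(maximalIdeal R ^ k) = e) :
    Tendsto (fun n : ℕ => ((Module.length R (R ⧸ maximalIdeal R ^ n)).toNat : ℝ) / n) atTop
      (𝓝 e) := by
  set l : ℕ → ℕ := fun n => (Module.length R (R ⧸ maximalIdeal R ^ n)).toNat with hl
  have hsucc : ∀ n, l (n + 1) = numGenerators R ↥(maximalIdeal R ^ n) + l n := by
    intro n
    have h1 := length_quotient_pow_succ_smul (R := R) (N := R) n
    have h2 := length_quotient_pow_smul_ne_top (R := R) (N := R) n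
    have hmul : ∀ k, (maximalIdeal R ^ k • ⊤ : Submodule R R) = maximalIdeal R ^ k := fun k => by
      rw [smul_eq_mul, Ideal.mul_top]
    rw [hmul, hmul] at h1
    rw [hmul] at h2
    simp only [hl]
    rw [h1, ENat.toNat_add (ENat.natCast_ne_top _) h2, ENat.toNat_natCast]
  have hlin : ∀ n, l (K + n) = l K + e * n := by
    intro n
    induction n with
    | zero => simp
    | succ n ih => rw [← add_assoc, hsucc, ih, h _ (by omega)]; ring
  have hlim : Tendsto (fun n : ℕ => ((l K : ℝ) - e * K) / n + e) atTop (𝓝 (0 + e)) :=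
    (tendsto_const_div_atTop_nhds_zero_nat _).add tendsto_const_nhds
  rw [zero_add] at hlim
  refine hlim.congr' ?_
  filter_upwards [eventually_ge_atTop K, eventually_gt_atTop 0] with n hn hn0
  obtain ⟨t, rfl⟩ := Nat.exists_eq_add_of_le hn
  change _ = (l (K + t) : ℝ) / _
  rw [hlin]
  have : ((K + t : ℕ) : ℝ) ≠ 0 := by exact_mod_cast hn0.ne'
  field_simp
  push_cast
  ring

theorem localMultiplicity_eq (hdim : ringKrullDim R = 1) {e K : ℕ}
    (h : ∀ k ≥ K, numGenerators R ↥(maximalIdeal R ^ k) = e) : localMultiplicity R = e := by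
  have hd : localDim R = 1 := by rw [localDim, hdim]; rfl
  refine Tendsto.limUnder_eq ?_
  simpa [hd] using tendsto_length_quotient_pow h

/-- In a one-dimensional Noetherian local ring some matrix behaves like a minimal reduction of the
maximal ideal, and the multiplicity is the eventual number of generators of its powers. -/
theorem exists_isMatrixReduction_localMultiplicity (hdim : ringKrullDim R = 1) :
    ∃ (d : ℕ) (_ : 0 < d) (A : Matrix (Fin d) (Fin d) R) (k₀ e : ℕ),
      IsMatrixReduction (maximalIdeal R) A k₀ ∧ 0 < e ∧ localMultiplicity R = e ∧
        ∃ k ≥ k₀, numGenerators R ↥(maximalIdeal R ^ k) = e := by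
  obtain ⟨c, hc⟩ := exists_numGenerators_pow_le hdim
  obtain ⟨d, hd, A, k₀, hA⟩ := exists_isMatrixReduction hc
  let f : ℕ → ℕ := fun k => numGenerators R ↥(maximalIdeal R ^ (k₀ + k))
  have hf : Antitone f := antitone_nat_of_succ_le fun k =>
    hA.numGenerators_pow_succ_le hd (Nat.le_add_right k₀ k)
  -- From k₀ on, A maps powers of 𝔪 onto the next ones, so ν(𝔪^k) is nonincreasing and constant once
  -- it reaches its minimum.
  obtain ⟨_, ⟨K, rfl⟩, hK⟩ := WellFounded.has_min (wellFounded_lt (α := ℕ)) (Set.range f) ⟨_, 0, rfl⟩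
  have hconst : ∀ k ≥ k₀ + K, numGenerators R ↥(maximalIdeal R ^ k) = f K := by
    intro k hk
    obtain ⟨t, rfl⟩ := Nat.exists_eq_add_of_le hk
    rw [add_assoc]
    exact (hf (Nat.le_add_right K t)).antisymm (not_lt.mp (hK _ ⟨K + t, rfl⟩))
  refine ⟨d, hd, A, k₀, f K, hA, Nat.pos_of_ne_zero fun h0 => ?_, localMultiplicity_eq hdim hconst,
    k₀ + K, Nat.le_add_right _ _, rfl⟩
  rw [numGenerators_eq_zero_iff, Submodule.subsingleton_iff_eq_bot] at h0
  exact maximalIdeal_pow_ne_bot hdim _ h0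

end multiplicity

/-! ### Modules of constant rank over the total fraction ring -/

section rank

variable {R : Type*} [CommRing R] {M : Type*} [AddCommGroup M] [Module R M]

theorem free_and_finrank_tensorProduct_of_isUnit {p : Ideal R} [p.IsPrime] {r : ℕ}
    (hfree : Module.Free (Localization.AtPrime p) (LocalizedModule p.primeCompl M))
    (hrank : Module.finrank (Localization.AtPrime p) (LocalizedModule p.primeCompl M) = r)
    (K : Type*) [CommRing K] [Nontrivial K] [Algebra R K]
    (hK : ∀ a ∉ p, IsUnit (algebraMap R K a)) :
    Module.Free K (K ⊗[R] M) ∧ Module.finrank K (K ⊗[R] M) = r := by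
  let L := Localization.AtPrime p
  let f : L →+* K := IsLocalization.lift (M := p.primeCompl) (g := algebraMap R K)
    fun y => hK y y.2
  let := f.toAlgebra
  have : IsScalarTower R L K := IsScalarTower.of_algebraMap_eq fun a =>
    (IsLocalization.lift_eq _ a).symm
  have e₁ : LocalizedModule p.primeCompl M ≃ₗ[L] L ⊗[R] M :=
    LocalizedModule.equivTensorProduct p.primeCompl M
  have hfree' : Module.Free L (L ⊗[R] M) := Module.Free.of_equiv e₁
  have e₂ : K ⊗[L] (L ⊗[R] M) ≃ₗ[K] K ⊗[R] M :=
    TensorProduct.AlgebraTensorModule.cancelBaseChange R L K K M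
  refine ⟨Module.Free.of_equiv e₂, ?_⟩
  rw [← e₂.finrank_eq, Module.finrank_baseChange, ← e₁.finrank_eq, hrank]

variable [IsNoetherianRing R]

/-- The contraction of a proper ideal consists of zero divisors, which form a finite union of
associated primes; prime avoidance applies. -/
theorem exists_mem_associatedPrimes_of_ne_top {P : Ideal (FractionRing R)} (hP : P ≠ ⊤) :
    ∃ p ∈ associatedPrimes R R, P.comap (algebraMap R (FractionRing R)) ≤ p := by
  have h := (P.comap (algebraMap R (FractionRing R))).subset_union_prime_finite
    (associatedPrimes.finite R R) (f := id) 0 0 fun _ h _ _ => h.isPrime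
  obtain ⟨p, hp, hle⟩ := h.mp <| by
    simp_rw [id, biUnion_associatedPrimes_eq_compl_nonZeroDivisors]
    exact fun x hx hreg => hP (P.eq_top_of_isUnit_mem hx
      (IsLocalization.map_units (FractionRing R) (⟨x, hreg⟩ : nonZeroDivisors R)))
  exact ⟨p, hp, hle⟩

/-- Every maximal ideal of the total fraction ring contracts into an associated prime of R, so the
base change of M is locally free of rank r. It is therefore flat with constant fibre rank, hence
free over this semilocal ring. -/
theorem ModuleHasRank.nonempty_basis [Module.Finite R M] {r : ℕ} (hr : ModuleHasRank R M r) :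
    Nonempty (Module.Basis (Fin r) (FractionRing R) (FractionRing R ⊗[R] M)) := by
  set Q := FractionRing R
  have hQ : IsNoetherianRing Q := IsLocalization.isNoetherianRing (nonZeroDivisors R) Q inferInstance
  have key : ∀ (P : Ideal Q) (K : Type _) [CommRing K] [Nontrivial K] [Algebra Q K],
      P.IsMaximal → (∀ a ∉ P, IsUnit (algebraMap Q K a)) →
      Module.Free K (K ⊗[Q] (Q ⊗[R] M)) ∧ Module.finrank K (K ⊗[Q] (Q ⊗[R] M)) = r := by
    intro P K _ _ _ hP hK
    obtain ⟨p, hp, hle⟩ := exists_mem_associatedPrimes_of_ne_top hP.ne_top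
    have := hp.isPrime
    obtain ⟨h₁, h₂⟩ := hr p hp
    let : Algebra R K := ((algebraMap Q K).comp (algebraMap R Q)).toAlgebra
    have : IsScalarTower R Q K := IsScalarTower.of_algebraMap_eq fun _ => rfl
    obtain ⟨h₃, h₄⟩ := free_and_finrank_tensorProduct_of_isUnit h₁ h₂ K fun a ha =>
      hK _ fun h => ha (hle h)
    have e : K ⊗[Q] (Q ⊗[R] M) ≃ₗ[K] K ⊗[R] M :=
      TensorProduct.AlgebraTensorModule.cancelBaseChange R Q K K M
    exact ⟨Module.Free.of_equiv e.symm, e.finrank_eq.trans h₄⟩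
  have hflat : Module.Flat Q (Q ⊗[R] M) := by
    refine Module.flat_of_isLocalized_maximal (R := Q) Q (Q ⊗[R] M)
      (fun P _ => Localization.AtPrime P ⊗[Q] (Q ⊗[R] M))
      (fun P _ => TensorProduct.mk Q (Localization.AtPrime P) (Q ⊗[R] M) 1) fun P hP => ?_
    have := (key P (Localization.AtPrime P) hP fun a ha =>
      IsLocalization.map_units _ (⟨a, ha⟩ : P.primeCompl)).1
    exact Module.Flat.trans Q (Localization.AtPrime P) _
  refine Module.nonempty_basis_of_flat_of_finrank_eq Q (Q ⊗[R] M) r fun P => ?_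
  have hP := P.isMaximal
  let := Ideal.Quotient.field P.asIdeal
  refine (key P.asIdeal (Q ⧸ P.asIdeal) hP fun a ha => ?_).2
  exact (isUnit_iff_ne_zero).mpr fun h => ha (Ideal.Quotient.eq_zero_iff_mem.mp h)

/-- A finite module of rank `r` is isomorphic to `R ^ r` up to a nonzerodivisor. -/
theorem ModuleHasRank.exists_linearMap [Module.Finite R M] {r : ℕ} (hr : ModuleHasRank R M r) :
    ∃ z ∈ nonZeroDivisors R, ∃ (φ : (Fin r → R) →ₗ[R] M) (ψ : M →ₗ[R] (Fin r → R)),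
      (∀ m, φ (ψ m) = z • m) ∧ ∀ v, ψ (φ v) = z • v := by
  obtain ⟨b⟩ := hr.nonempty_basis
  set Q := FractionRing R
  have := Module.finitePresentation_of_finite R M
  let e : Q ⊗[R] (Fin r → R) ≃ₗ[R] Q ⊗[R] M :=
    ((((Pi.basisFun R (Fin r)).baseChange Q).equiv b (Equiv.refl _))).restrictScalars R
  let lF : (Fin r → R) →ₗ[R] Q ⊗[R] (Fin r → R) := TensorProduct.mk R Q (Fin r → R) 1
  let lM : M →ₗ[R] Q ⊗[R] M := TensorProduct.mk R Q M 1
  have hlF : IsLocalizedModule (nonZeroDivisors R) lF :=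
    (isLocalizedModule_iff_isBaseChange _ Q _).mpr (TensorProduct.isBaseChange R (Fin r → R) Q)
  have hlM : IsLocalizedModule (nonZeroDivisors R) lM :=
    (isLocalizedModule_iff_isBaseChange _ Q _).mpr (TensorProduct.isBaseChange R M Q)
  obtain ⟨φ, s₁, h₁⟩ := Module.FinitePresentation.exists_lift_of_isLocalizedModule
    (nonZeroDivisors R) lM (e.toLinearMap ∘ₗ lF)
  obtain ⟨ψ, s₂, h₂⟩ := Module.FinitePresentation.exists_lift_of_isLocalizedModule
    (nonZeroDivisors R) lF (e.symm.toLinearMap ∘ₗ lM)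
  have h₁' : ∀ v, lM (φ v) = (s₁ : R) • e (lF v) := fun v => LinearMap.congr_fun h₁ v
  have h₂' : ∀ m, lF (ψ m) = (s₂ : R) • e.symm (lM m) := fun m => LinearMap.congr_fun h₂ m
  obtain ⟨s₃, h₃⟩ := Module.Finite.exists_smul_of_comp_eq_of_isLocalizedModule
    (nonZeroDivisors R) lM (φ ∘ₗ ψ) ((s₁ * s₂ : R) • LinearMap.id) (by
      ext m
      simp only [LinearMap.comp_apply, LinearMap.smul_apply, LinearMap.id_apply, map_smul, h₁', h₂',
        LinearEquiv.apply_symm_apply, mul_smul])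
  obtain ⟨s₄, h₄⟩ := Module.Finite.exists_smul_of_comp_eq_of_isLocalizedModule
    (nonZeroDivisors R) lF (ψ ∘ₗ φ) ((s₁ * s₂ : R) • LinearMap.id) (by
      ext1 v
      ext
      simp only [LinearMap.comp_apply, LinearMap.smul_apply, LinearMap.id_apply, map_smul, h₁', h₂',
        LinearEquiv.symm_apply_apply, mul_smul]
      rw [smul_comm])
  have h₃' : ∀ m, (s₃ : R) • φ (ψ m) = (s₃ : R) • (s₁ * s₂ : R) • m := fun m =>
    LinearMap.congr_fun h₃ m
  have h₄' : ∀ v, (s₄ : R) • ψ (φ v) = (s₄ : R) • (s₁ * s₂ : R) • v := fun v =>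
    LinearMap.congr_fun h₄ v
  -- The compositions equal s₁s₂ only after multiplication by s₃ and s₄; absorbing both factors into
  -- φ makes the two identities exact with the same z.
  refine ⟨(s₄ * s₃ : R) * (s₁ * s₂ : R), mul_mem (mul_mem s₄.2 s₃.2) (mul_mem s₁.2 s₂.2),
    (s₄ * s₃ : R) • φ, ψ, fun m => ?_, fun v => ?_⟩
  · rw [LinearMap.smul_apply, mul_smul, h₃']
    simp only [mul_smul]
  · rw [LinearMap.smul_apply, map_smul, mul_comm (s₄ : R), mul_smul, h₄']
    simp only [mul_smul]

end rank

/-! ### Bounds for overideals of the trace and for M ⊗ M* -/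

section bounds

open IsLocalRing

variable {R : Type*} [CommRing R] {M : Type*} [AddCommGroup M] [Module R M]

theorem numGenerators_self [Nontrivial R] : numGenerators R R = 1 := by
  rw [numGenerators, ← Module.finrank_eq_spanFinrank_of_free, Module.finrank_self]

theorem apply_mem_of_moduleTrace_le {J : Ideal R} (hJ : moduleTrace R M ≤ J)
    (h : Module.Dual R M) (m : M) : h m ∈ J :=
  hJ ⟨h ⊗ₜ m, contractLeft_apply h m⟩

theorem moduleTrace_eq_top_of_equiv {r : ℕ} (e : M ≃ₗ[R] (Fin r → R)) (i : Fin r) :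
    moduleTrace R M = ⊤ := by
  rw [Ideal.eq_top_iff_one]
  exact ⟨(LinearMap.proj i ∘ₗ e.toLinearMap) ⊗ₜ e.symm (Pi.single i 1), by simp⟩

variable [IsLocalRing R] [IsNoetherianRing R] [Module.Finite R M]

theorem IsMatrixReduction.exists_numGenerators_ideal_le {d : ℕ} [NeZero d]
    {A : Matrix (Fin d) (Fin d) R} {k₀ k : ℕ} (hA : IsMatrixReduction (maximalIdeal R) A k₀)
    (hk : k₀ ≤ k) {y : R} (hy : y ∈ maximalIdeal R) (hreg : IsRegular y) {r : ℕ}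
    (hr : ModuleHasRank R M r) {J : Ideal R} (hJ : moduleTrace R M ≤ J) :
    ∃ c : ℕ, numGenerators R M * numGenerators R J ≤ numGenerators R (Module.Dual R M) + c ∧
      c + r * numGenerators R ↥(maximalIdeal R ^ k) ≤
        numGenerators R M * numGenerators R ↥(maximalIdeal R ^ k) ∧
      (J = ⊤ → c = 0 → Module.Free R M) := by
  obtain ⟨z, hz, φ, ψ, hφψ, hψφ⟩ := hr.exists_linearMap
  have hz0 : ∀ a : R, z * a = 0 → a = 0 := fun a ha =>
    (isRegular_iff_mem_nonZeroDivisors.mpr hz).left (ha.trans (mul_zero z).symm)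
  set n := numGenerators R M
  obtain ⟨π, hπ⟩ : ∃ π : (Fin n → R) →ₗ[R] M, Function.Surjective π :=
    exists_surjective_of_numGenerators
  obtain ⟨φ', hφ'⟩ := Module.projective_lifting_property π φ hπ
  have hφ'' : ∀ u, π (φ' u) = φ u := fun u => LinearMap.congr_fun hφ' u
  -- Over the total fraction ring, κ is z times the projection onto ker π along the image of φ'. Its
  -- dual therefore has kernel M* and image independent of a copy of R^r.
  let κ : (Fin n → R) →ₗ[R] (Fin n → R) := z • LinearMap.id - φ' ∘ₗ ψ ∘ₗ π
  have hκ : ∀ v, κ v = z • v - φ' (ψ (π v)) := fun v => rfl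
  have hκφ : ∀ u, κ (φ' u) = 0 := fun u => by
    rw [hκ, hφ'', hψφ, map_smul, sub_self]
  have hπκ : ∀ v, π (κ v) = 0 := fun v => by
    rw [hκ, map_sub, map_smul, hφ'', hφψ, sub_self]
  let D : (Fin n → J) →ₗ[R] Module.Dual R (Fin n → R) :=
    (Module.piEquiv (Fin n) R R).toLinearMap ∘ₗ J.subtype.compLeft (Fin n)
  let Θ : (Fin n → J) →ₗ[R] Module.Dual R (Fin n → R) := κ.dualMap ∘ₗ D
  have hΘ : ∀ f v, Θ f v = D f (κ v) := fun f v => rfl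
  let τ : Module.Dual R M →ₗ[R] (Fin n → J) :=
    LinearMap.pi fun i => LinearMap.codRestrict J
      (LinearMap.applyₗ (π (Pi.single i 1))) fun h => apply_mem_of_moduleTrace_le hJ h _
  have hDτ : ∀ h v, D (τ h) v = h (π v) := fun h v => by
    have : D (τ h) = h ∘ₗ π := by
      ext i
      simp [D, τ, Module.piEquiv_apply_apply, Pi.single_apply]
      rfl
    rw [this, LinearMap.comp_apply]
  have hDinj : Function.Injective D :=
    (Module.piEquiv (Fin n) R R).injective.comp (J.injective_subtype.comp_left)
  have hexact : Function.Exact τ Θ.rangeRestrict := by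
    intro f
    rw [Subtype.ext_iff]
    change Θ f = 0 ↔ _
    constructor
    · intro hf
      -- On ker π the map κ is multiplication by z, so a functional that kills the image of κ
      -- vanishes on ker π and factors through M.
      have hle : LinearMap.ker π ≤ LinearMap.ker (D f) := by
        intro v hv
        have h1 := LinearMap.congr_fun hf v
        rw [hΘ, hκ, LinearMap.mem_ker.mp hv, map_zero, map_zero, sub_zero, map_smul] at h1
        exact hz0 _ h1
      refine ⟨(LinearMap.ker π).liftQ (D f) hle ∘ₗ
        (π.quotKerEquivOfSurjective hπ).symm.toLinearMap, hDinj (LinearMap.ext fun v => ?_)⟩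
      have h1 : (π.quotKerEquivOfSurjective hπ).symm (π v) = Submodule.Quotient.mk v := by
        rw [LinearEquiv.symm_apply_eq]
        rfl
      rw [hDτ, LinearMap.comp_apply, LinearEquiv.coe_coe, h1]
      rfl
    · rintro ⟨h, rfl⟩
      refine LinearMap.ext fun v => ?_
      rw [hΘ, hDτ, hπκ, map_zero]
      rfl
  refine ⟨numGenerators R (LinearMap.range Θ), ?_, ?_, ?_⟩
  · rw [← numGenerators_pi]
    exact numGenerators_le_add _ Θ.surjective_rangeRestrict τ hexact
  · let G : (Fin r → R) →ₗ[R] Module.Dual R (Fin n → R) :=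
      (ψ ∘ₗ π).dualMap ∘ₗ (Module.piEquiv (Fin r) R R).toLinearMap
    have hG : ∀ g v, G g v = Module.piEquiv (Fin r) R R g (ψ (π v)) := fun g v => rfl
    let f : (LinearMap.range Θ × (Fin r → R)) →ₗ[R] (Fin n → R) :=
      (Module.piEquiv (Fin n) R R).symm.toLinearMap ∘ₗ
        LinearMap.coprod (LinearMap.range Θ).subtype G
    have hf : Function.Injective f := by
      refine (Module.piEquiv (Fin n) R R).symm.injective.comp ((injective_iff_map_eq_zero _).mpr ?_)
      rintro ⟨⟨_, t, rfl⟩, g⟩ h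
      rw [LinearMap.coprod_apply, Submodule.subtype_apply] at h
      have hg : g = 0 := by
        refine (Module.piEquiv (Fin r) R R).injective (LinearMap.ext fun u => ?_)
        -- Evaluation on the image of φ' isolates g, since κ φ' = 0 and ψ π φ' = z.
        have h1 := LinearMap.congr_fun h (φ' u)
        rw [LinearMap.add_apply, hΘ, hκφ, map_zero, zero_add, hG, hφ'', hψφ, map_smul] at h1
        rw [map_zero]
        exact hz0 _ h1
      subst hg
      rw [map_zero, add_zero] at h
      exact Prod.ext (Subtype.ext h) rfl
    exact hA.numGenerators_add_le hy hreg hk f hf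
  · rintro rfl h0
    rw [numGenerators_eq_zero_iff, Submodule.subsingleton_iff_eq_bot, LinearMap.range_eq_bot] at h0
    -- With J = R and Θ = 0 all coordinate functionals vanish on the image of κ, which contains z •
    -- ker π.
    have hinj : Function.Injective π := by
      rw [← LinearMap.ker_eq_bot, LinearMap.ker_eq_bot']
      intro v hv
      ext i
      have h1 := LinearMap.congr_fun (LinearMap.congr_fun h0 (Pi.single i ⟨1, trivial⟩)) v
      rw [hΘ, hκ, hv, map_zero, map_zero, sub_zero, map_smul] at h1
      have h2 := hz0 _ h1
      simpa [D, Module.piEquiv_apply_apply, Pi.single_apply, apply_ite] using h2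
    exact Module.Free.of_equiv (LinearEquiv.ofBijective π ⟨hinj, hπ⟩)

/-- The map ψ ⊗ φ* into a free module of rank r² becomes z² after composing with φ ⊗ ψ*, so
torsionfreeness makes it injective and the generator count applies. -/
theorem IsMatrixReduction.numGenerators_tensorProduct_dual_le {d : ℕ} [NeZero d]
    {A : Matrix (Fin d) (Fin d) R} {k₀ k : ℕ} (hA : IsMatrixReduction (maximalIdeal R) A k₀)
    (hk : k₀ ≤ k) {y : R} (hy : y ∈ maximalIdeal R) (hreg : IsRegular y) {r : ℕ}
    (hr : ModuleHasRank R M r) (htf : Module.IsTorsionFree R (M ⊗[R] Module.Dual R M)) :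
    numGenerators R (M ⊗[R] Module.Dual R M) ≤
      r * r * numGenerators R ↥(maximalIdeal R ^ k) := by
  obtain ⟨z, hz, φ, ψ, hφψ, hψφ⟩ := hr.exists_linearMap
  let T : M ⊗[R] Module.Dual R M →ₗ[R] (Fin r → R) ⊗[R] Module.Dual R (Fin r → R) :=
    TensorProduct.map ψ φ.dualMap
  have hT : (TensorProduct.map φ ψ.dualMap) ∘ₗ T = (z * z) • LinearMap.id := by
    ext m h
    have h1 : ψ.dualMap (φ.dualMap h) = z • h := by
      ext x
      simp [hφψ]
    simp [T, hφψ, h1, TensorProduct.smul_tmul', TensorProduct.tmul_smul, mul_smul]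
  have hTinj : Function.Injective T := by
    rw [← LinearMap.ker_eq_bot, LinearMap.ker_eq_bot']
    intro x hx
    have h1 := LinearMap.congr_fun hT x
    rw [LinearMap.comp_apply, hx, map_zero, LinearMap.smul_apply, LinearMap.id_apply] at h1
    have hzz : IsRegular (z * z) :=
      (isRegular_iff_mem_nonZeroDivisors.mpr hz).mul (isRegular_iff_mem_nonZeroDivisors.mpr hz)
    exact hzz.isSMulRegular (by simpa using h1.symm)
  have hrk : Module.finrank R ((Fin r → R) ⊗[R] Module.Dual R (Fin r → R)) = r * r := by
    rw [Module.finrank_tensorProduct, (Module.piEquiv (Fin r) R R).finrank_eq.symm]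
    simp
  let e := (Module.finBasisOfFinrankEq R _ hrk).equivFun
  have h := hA.numGenerators_add_le hy hreg hk (r := 0) (n := r * r)
    (e.toLinearMap ∘ₗ T ∘ₗ LinearMap.fst R _ (Fin 0 → R)) (fun a b hab =>
      Prod.ext (hTinj (e.injective hab)) (Subsingleton.elim _ _))
  simpa using h

/-- In depth zero the nonzerodivisor z is a unit, so φ and ψ are inverse up to a unit. -/
theorem ModuleHasRank.nonempty_equiv {r : ℕ} (hr : ModuleHasRank R M r)
    (hdepth : ∀ y ∈ maximalIdeal R, ¬ IsRegular y) : Nonempty (M ≃ₗ[R] (Fin r → R)) := by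
  obtain ⟨z, hz, φ, ψ, hφψ, hψφ⟩ := hr.exists_linearMap
  have hu : IsUnit z := by
    by_contra h
    exact hdepth z ((mem_maximalIdeal z).mpr h) (isRegular_iff_mem_nonZeroDivisors.mpr hz)
  refine ⟨LinearEquiv.ofBijective ψ ⟨fun a b hab => ?_, fun v => ?_⟩⟩
  · have h : z • a = z • b := by rw [← hφψ, ← hφψ, hab]
    exact hu.smul_left_cancel.mp h
  · refine ⟨φ (hu.unit⁻¹ • v), ?_⟩
    rw [hψφ]
    exact smul_inv_smul hu.unit v

end bounds

/-! ### The main inequalities -/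

theorem proposition3p3 {R : Type*} [CommRing R] [IsLocalRing R] [IsNoetherianRing R]
    (hdim : ringKrullDim R = 1)
    {M : Type*} [AddCommGroup M] [Module R M] [Module.Finite R M] [Nontrivial M]
    (r : ℕ) (hr : ModuleHasRank R M r)
    (htf : Module.IsTorsionFree R (M ⊗[R] Module.Dual R M))
    (ρ : ℝ) (hρ : ρ = (r : ℝ) / (numGenerators R M : ℝ))
    (J : Ideal R) (hJ : moduleTrace R M ≤ J) :
    (numGenerators R J : ℝ) ≤
        localMultiplicity R * (1 - ρ) +
          (numGenerators R (M ⊗[R] Module.Dual R M) : ℝ) / (numGenerators R M : ℝ) ^ 2 ∧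
      localMultiplicity R * (1 - ρ) +
          (numGenerators R (M ⊗[R] Module.Dual R M) : ℝ) / (numGenerators R M : ℝ) ^ 2 ≤
        localMultiplicity R * (1 - ρ + ρ ^ 2) ∧
      (0 < r → ¬ Module.Free R M → (numGenerators R J : ℝ) ≤ localMultiplicity R - 1) := by
  obtain ⟨d, hd, A, k₀, e, hA, he, hmult, k, hk, hke⟩ :=
    exists_isMatrixReduction_localMultiplicity hdim
  have : NeZero d := ⟨hd.ne'⟩
  have hn : 0 < numGenerators R M := Nat.pos_of_ne_zero fun h =>
    not_subsingleton M (numGenerators_eq_zero_iff.mp h)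
  have hnR : (0 : ℝ) < numGenerators R M := by exact_mod_cast hn
  have heR : (1 : ℝ) ≤ e := by exact_mod_cast he
  rw [hmult]
  by_cases hdepth : ∃ y ∈ IsLocalRing.maximalIdeal R, IsRegular y
  · obtain ⟨y, hy, hreg⟩ := hdepth
    have hT := hA.numGenerators_tensorProduct_dual_le hk hy hreg hr htf
    obtain ⟨c, hc₁, hc₂, -⟩ := hA.exists_numGenerators_ideal_le hk hy hreg hr hJ
    rw [hke] at hT hc₂
    rw [numGenerators_tensorProduct] at hT ⊢
    have hc₁' : (numGenerators R M : ℝ) * numGenerators R J ≤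
      numGenerators R (Module.Dual R M) + c := by exact_mod_cast hc₁
    have hc₂' : (c : ℝ) + r * e ≤ numGenerators R M * e := by exact_mod_cast hc₂
    have hT' : (numGenerators R M : ℝ) * numGenerators R (Module.Dual R M) ≤ r * r * e := by
      exact_mod_cast hT
    set n : ℝ := (numGenerators R M : ℝ)
    have hfirst : (numGenerators R J : ℝ) ≤ e * (1 - ρ) +
        (numGenerators R M * numGenerators R (Module.Dual R M) : ℕ) / n ^ 2 := by
      have h1 : e * (1 - ρ) + ((numGenerators R M * numGenerators R (Module.Dual R M) : ℕ) : ℝ) /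
          n ^ 2 = (e * (n - r) + numGenerators R (Module.Dual R M)) / n := by
        rw [hρ]
        push_cast
        rw [show ((numGenerators R M : ℕ) : ℝ) = n from rfl]
        field_simp
      rw [h1, le_div_iff₀ hnR]
      linarith
    have hsecond : e * (1 - ρ) +
        ((numGenerators R M * numGenerators R (Module.Dual R M) : ℕ) : ℝ) / n ^ 2 ≤
        e * (1 - ρ + ρ ^ 2) := by
      have h1 : (e : ℝ) * (1 - ρ + ρ ^ 2) = e * (1 - ρ) + r * r * e / n ^ 2 := by
        rw [hρ]
        field_simp
      rw [h1]
      gcongr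
      exact_mod_cast hT
    refine ⟨hfirst, hsecond, fun hr0 hfree => ?_⟩
    -- The case J = R shows r < n: otherwise the count forces c' = 0, and M would be free.
    obtain ⟨c', -, hc₂', hc₃⟩ := hA.exists_numGenerators_ideal_le hk hy hreg hr
      (le_top : moduleTrace R M ≤ ⊤)
    have hlt : r < numGenerators R M := by
      by_contra hle
      refine hfree (hc₃ rfl ?_)
      rw [hke] at hc₂'
      have := Nat.mul_le_mul_right e (not_lt.mp hle)
      omega
    have hρ0 : 0 < ρ := by rw [hρ]; positivity
    have hρ1 : ρ < 1 := by rw [hρ, div_lt_one hnR]; exact Nat.cast_lt.mpr hlt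
    -- Since 0 < ρ < 1, the factor 1 - ρ + ρ² is less than 1; both sides being integers, the strict
    -- inequality improves by one.
    have h2 : (numGenerators R J : ℝ) < e := by
      refine (hfirst.trans hsecond).trans_lt ?_
      nlinarith [mul_pos hρ0 (sub_pos.mpr hρ1)]
    have h3 : numGenerators R J + 1 ≤ e := by exact_mod_cast h2
    have h4 : (numGenerators R J : ℝ) + 1 ≤ e := by exact_mod_cast h3
    linarith
  -- In depth zero M is free of rank r = ν(M) > 0, so its trace is R and ρ = 1; the bounds reduce to
  -- 1 ≤ 1 ≤ e.
  · push Not at hdepth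
    obtain ⟨E⟩ := hr.nonempty_equiv hdepth
    have hfree : Module.Free R M := Module.Free.of_equiv E.symm
    have hnr : numGenerators R M = r := by
      rw [E.numGenerators_eq, numGenerators_pi, numGenerators_self, mul_one]
    have hdual : numGenerators R (Module.Dual R M) = r := by
      rw [← E.dualMap.numGenerators_eq, ← (Module.piEquiv (Fin r) R R).numGenerators_eq,
        numGenerators_pi, numGenerators_self, mul_one]
    have hJtop : J = ⊤ := top_le_iff.mp
      (moduleTrace_eq_top_of_equiv E ⟨0, hnr ▸ hn⟩ ▸ hJ)
    have hJ1 : numGenerators R J = 1 := by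
      rw [hJtop, Submodule.topEquiv.numGenerators_eq, numGenerators_self]
    rw [hnr] at hnR hρ
    rw [div_self hnR.ne'] at hρ
    rw [numGenerators_tensorProduct, hdual, hnr, hJ1, hρ]
    push_cast
    have h1 : (r * r : ℝ) / r ^ 2 = 1 := by field_simp
    rw [h1]
    exact ⟨by norm_num, by linarith, fun _ h => absurd hfree h⟩
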